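/- Let \(d,m,s\ge 1\), let \(\Omega\subset\mathbb{R}^d\) be a lattice with fundamental domain \(F\) (the half-open cell spanned by a basis of \(\Omega\)), and let \(\Gamma=\{\gamma\in\mathbb{R}^d:\langle\gamma,\omega\rangle\in 2\pi\mathbb{Z}\ \text{for all }\omega\in\Omega\}\) be the dual lattice. Put \(D_\alpha=(\tfrac1i\partial_{x_1})^{\alpha_1}\cdots(\tfrac1i\partial_{x_d})^{\alpha_d}\) and \[ Tu=\sum_{|\alpha|=2s}Q_\alpha D_\alpha u+\sum_{|\alpha|\le 2s-1}Q_\alpha(x)D_\alpha u+Bu , \] where the \(Q_\alpha\), \(|\alpha|=2s\), are constant real \(m\times m\) matrices, the \(Q_\alpha(x)\), \(|\alpha|\le 2s-1\), are \(m\times m\) matrices whose entries are bounded \(\Omega\)-periodic functions, and \(B\) is a bounded operator commuting with the shifts \(u(x)\mapsto u(x+\omega)\), \(\omega\in\Omega\); for \(t\in\mathbb{R}^d\) it acts on the functions satisfying \[ u(x+\omega)=e^{i\langle t,\omega\rangle}u(x)\qquad(\omega\in\Omega),\tag{Q} \] identified with \(L_2^m(F)\) by restriction to \(F\), as a bounded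 operator \(B_t\) that depends only on \(t\) modulo \(\Gamma\) and is norm-continuous in \(t\) (for instance, \(B_t\) independent of \(t\)). Let \(T_t\) be the operator in \(L_2^m(F)\) given by this expression, with \(B_t\) in place of \(B\), on the domain of all \(u\) satisfying (Q) whose weak derivatives of order \(\le 2s\) belong to \(L_2^m(F)\). For a set \(E\subset\mathbb{R}^d\) consider the condition (A) for every \(t\in E\) the operator \(T_t\) is self-adjoint, bounded below and has compact resolvent, and there are \(\varepsilon,c>0\) with \[ \|T_tu+cu-B_tu\|+\|u\|\ \ge\ \varepsilon\sum_{|\alpha|\le 2s-1}\|D_\alpha u\|\qquad\text{for all }t\in E,\ u\in D(T_t). \] Assume that (A) holds for \(E=F^\star\), where \(F^\star\) is a fundamental domain of \(\Gamma\) (only \(F^\star+\Gamma=\mathbb{R}^d\) is needed). Let \(\lambda_1(t)\le\lambda_2(t)\le\cdots\) be the eigenvalues of \(T_t\), counted with multiplicity. Call \(E\subset\mathbb{R}^d\) a *fundamental set* if (a) \(E+\Gamma=\mathbb{R}^d\) and (b) no two points of \(E\) differ by a nonzero element of \(\Gamma\). For \(v\in\mathbb{C}^m\) and \(\Psi\in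 L_2^m(F)\) let \((\Psi,e^{i\langle t,x\rangle}v)\) be the inner product in \(L_2^m(F)\). Say that \(\lambda_n\) is *good on* \(U\subset\mathbb{R}^d\) if \(\lambda_n(t)\) is a simple eigenvalue of \(T_t\) for all \(t\in U\) and, for every \(v\in\mathbb{C}^m\), the number \(|(\Psi_{n,t},e^{i\langle t,x\rangle}v)|\) does not depend on the choice of the normalized eigenfunction \(\Psi_{n,t}\) of \(T_t\) for \(\lambda_n(t)\), \(t\in U\), and is a continuous function of \(t\in U\). 1. If \(n\ge 1\), \(a\in\mathbb{R}^d\) and \(\lambda_n(a)\) is a simple eigenvalue of \(T_a\), then \(a\) has an open neighbourhood \(U(a)\subset\mathbb{R}^d\) that is contained in some fundamental set and on which \(\lambda_n\) is good. 2. Every fundamental set \(E\) can be used as the fundamental domain \(F^\star\): every \(t\in\mathbb{R}^d\) is congruent modulo \(\Gamma\) to exactly one \(t'\in E\); \(T_t=T_{t'}\) whenever \(t-t'\in\Gamma\); condition (A) holds on \(E\); and if \(n\ge1\), \(a\in E\) and \(\lambda_n(a)\) is simple, then \(a\) has a neighbourhood \(U(a)\subset E\) relative to \(E\) (hence a neighbourhood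 in \(\mathbb{R}^d\) if \(a\) is interior to \(E\)) on which \(\lambda_n\) is good. -/

import Mathlib

open MeasureTheory
open scoped ContDiff InnerProductSpace Matrix

noncomputable section

/-! ## Spaces and lattices -/

/-- Real Euclidean space `ℝ^d`. -/
abbrev Rd (d : ℕ) : Type := EuclideanSpace ℝ (Fin d)

/-- Complex Euclidean space `ℂ^m`. -/
abbrev Cm (m : ℕ) : Type := EuclideanSpace ℂ (Fin m)

/-- The lattice `Ω` spanned over `ℤ` by the basis `b` of `ℝ^d`. -/
abbrev periodLattice {d : ℕ} (b : Module.Basis (Fin d) ℝ (Rd d)) : Submodule ℤ (Rd d) :=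
  Submodule.span ℤ (Set.range b)

/-- The lattice `Γ` dual to `Ω`: all `γ` with `⟨γ, ω⟩ ∈ 2πℤ` for all `ω ∈ Ω`. -/
def dualLattice {d : ℕ} (b : Module.Basis (Fin d) ℝ (Rd d)) : AddSubgroup (Rd d) where
  carrier := {γ | ∀ w ∈ periodLattice b, ∃ k : ℤ, ⟪γ, w⟫_ℝ = 2 * Real.pi * k}
  zero_mem' := fun w _ => ⟨0, by simp⟩
  add_mem' := by
    intro x y hx hy w hw
    obtain ⟨k, hk⟩ := hx w hw
    obtain ⟨l, hl⟩ := hy w hw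
    exact ⟨k + l, by rw [inner_add_left, hk, hl]; push_cast; ring⟩
  neg_mem' := by
    intro x hx w hw
    obtain ⟨k, hk⟩ := hx w hw
    exact ⟨-k, by rw [inner_neg_left, hk]; push_cast; ring⟩

/-- `E + Γ = ℝ^d`. -/
def CoversMod {d : ℕ} (Γ : AddSubgroup (Rd d)) (E : Set (Rd d)) : Prop :=
  {x : Rd d | ∃ t ∈ E, ∃ γ ∈ Γ, x = γ + t} = Set.univ

/-- Conditions (a) `E + Γ = ℝ^d` and (b) no two points of `E` differ by a nonzero element
of `Γ`. -/
def IsFundamentalSet {d : ℕ} (Γ : AddSubgroup (Rd d)) (E : Set (Rd d)) : Prop :=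
  CoversMod Γ E ∧ ∀ t ∈ E, ∀ γ ∈ Γ, γ ≠ 0 → γ + t ∉ E

/-- The fundamental domain `F` of `Ω`: the half-open cell spanned by the basis. -/
abbrev cell {d : ℕ} (b : Module.Basis (Fin d) ℝ (Rd d)) : Set (Rd d) :=
  ZSpan.fundamentalDomain b

/-- The Hilbert space `L_2^m(F)`. -/
abbrev L2cell {d : ℕ} (b : Module.Basis (Fin d) ℝ (Rd d)) (m : ℕ) : Type :=
  Lp (Cm m) 2 (volume.restrict (cell b))

/-- The extension of `u ∈ L_2^m(F)` to `ℝ^d` with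
`u(x + ω) = e^{i⟨t, ω⟩} u(x)` for all `ω ∈ Ω`. -/
def quasiExt {d : ℕ} (b : Module.Basis (Fin d) ℝ (Rd d)) {m : ℕ} (t : Rd d)
    (u : L2cell b m) (x : Rd d) : Cm m :=
  Complex.exp (Complex.I * (⟪t, (ZSpan.floor b x : Rd d)⟫_ℝ : ℝ)) • u (ZSpan.fract b x)

/-! ## Derivatives -/

/-- `(1/i) ∂/∂x_j`. -/
def partialD {d : ℕ} (j : Fin d) (φ : Rd d → ℂ) : Rd d → ℂ :=
  fun x => (1 / Complex.I) * fderiv ℝ φ x (EuclideanSpace.single j 1)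

/-- `D_α = ((1/i) ∂/∂x_1)^{α_1} ⋯ ((1/i) ∂/∂x_d)^{α_d}` for (smooth) scalar functions. -/
def multiD {d : ℕ} (α : Fin d → ℕ) (φ : Rd d → ℂ) : Rd d → ℂ :=
  (List.finRange d).foldr (fun j ψ => (partialD j)^[α j] ψ) φ

/-- `g ∈ L_2^m(F)` is the weak derivative `D_α u` of `u ∈ L_2^m(F)` under the quasiperiodic
conditions with quasimomentum `t`: the quasiperiodic extension of `g` is the weak derivative on
`ℝ^d` of the quasiperiodic extension of `u`. -/
def IsWeakD {d : ℕ} (b : Module.Basis (Fin d) ℝ (Rd d)) {m : ℕ} (t : Rd d) (α : Fin d → ℕ)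
    (u g : L2cell b m) : Prop :=
  ∀ φ : Rd d → ℂ, ContDiff ℝ ∞ φ → HasCompactSupport φ →
    ∫ x, φ x • quasiExt b t g x = (-1 : ℂ) ^ (∑ j, α j) • ∫ x, multiD α φ x • quasiExt b t u x

/-! ### The weak derivative is unique and linear -/

theorem integrableOn_quasiExt_floor {d : ℕ} (b : Module.Basis (Fin d) ℝ (Rd d)) {m : ℕ}
    (t : Rd d) (u : L2cell b m) (w : periodLattice b) :
    IntegrableOn (quasiExt b t u) {x | ZSpan.floor b x = w} := by
  have hF : MeasurableSet (cell b) := ZSpan.fundamentalDomain_measurableSet b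
  have hset : {x | ZSpan.floor b x = w} = (fun x : Rd d => x - (w : Rd d)) ⁻¹' cell b := by
    ext x
    simp only [Set.mem_ofPred_eq, Set.mem_preimage]
    constructor
    · intro h
      have := ZSpan.fract_mem_fundamentalDomain b x
      rwa [ZSpan.fract, h] at this
    · intro h
      have h1 := (ZSpan.fract_eq_self (b := b)).2 h
      have h2 : ZSpan.fract b (x - (w : Rd d)) = ZSpan.fract b x := by
        rw [sub_eq_add_neg]
        exact ZSpan.fract_add_ZSpan b x (neg_mem w.2)
      rw [h2, ZSpan.fract] at h1
      exact Subtype.ext (sub_right_injective h1)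
  have hfin : IsFiniteMeasure (volume.restrict (cell b) : Measure (Rd d)) :=
    ⟨by
      rw [Measure.restrict_apply_univ]
      exact (ZSpan.fundamentalDomain_isBounded b).measure_lt_top⟩
  have hu : IntegrableOn (fun x => (u x : Cm m)) (cell b) :=
    (Lp.memLp u).integrable (by norm_num)
  have hmp := measurePreserving_sub_right (volume : Measure (Rd d)) (w : Rd d)
  have hemb : MeasurableEmbedding (fun x : Rd d => x - (w : Rd d)) :=
    (MeasurableEquiv.subRight (w : Rd d)).measurableEmbedding
  have h1 := (hmp.integrableOn_comp_preimage hemb (s := cell b)).2 hu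
  rw [← hset] at h1
  have hms : MeasurableSet {x | ZSpan.floor b x = w} := by
    rw [hset]; exact hemb.measurable hF
  have h2 : IntegrableOn (Complex.exp (Complex.I * (⟪t, (w : Rd d)⟫_ℝ : ℝ)) •
      ((fun x => (u x : Cm m)) ∘ fun x => x - (w : Rd d))) {x | ZSpan.floor b x = w} :=
    Integrable.smul _ h1
  refine IntegrableOn.congr_fun h2 ?_ hms
  intro x hx
  have hx' : ZSpan.floor b x = w := hx
  simp [quasiExt, hx', ZSpan.fract]

theorem locallyIntegrable_quasiExt {d : ℕ} (b : Module.Basis (Fin d) ℝ (Rd d)) {m : ℕ}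
    (t : Rd d) (u : L2cell b m) : LocallyIntegrable (quasiExt b t u) := by
  rw [locallyIntegrable_iff]
  intro K hK
  obtain ⟨R, hR⟩ := hK.isBounded.exists_norm_le
  set S : Set (Rd d) := Metric.closedBall 0 (R + ∑ i, ‖b i‖) ∩ (periodLattice b : Set (Rd d))
    with hS
  have hSf : S.Finite := ZSpan.setFinite_inter b Metric.isBounded_closedBall
  set S' : Set (periodLattice b) := Subtype.val ⁻¹' S with hS'
  have hSf' : S'.Finite := hSf.preimage Subtype.val_injective.injOn
  have hint : IntegrableOn (quasiExt b t u) (⋃ w ∈ S', {x | ZSpan.floor b x = w}) :=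
    (integrableOn_finite_biUnion hSf').2 fun w _ => integrableOn_quasiExt_floor b t u w
  refine hint.mono_set fun x hx => ?_
  simp only [Set.mem_iUnion, Set.mem_ofPred_eq, exists_prop, exists_eq_right']
  refine ⟨?_, (ZSpan.floor b x).2⟩
  rw [mem_closedBall_zero_iff]
  have : (ZSpan.floor b x : Rd d) = x - ZSpan.fract b x := by simp [ZSpan.fract]
  rw [this]
  exact (norm_sub_le _ _).trans (add_le_add (hR x hx) (ZSpan.norm_fract_le b x))

theorem contDiff_partialD {d : ℕ} (j : Fin d) {φ : Rd d → ℂ} (h : ContDiff ℝ ∞ φ) :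
    ContDiff ℝ ∞ (partialD j φ) := by
  unfold partialD
  exact contDiff_const.mul ((h.fderiv_right (m := ∞) (by simp)).clm_apply contDiff_const)

theorem hasCompactSupport_partialD {d : ℕ} (j : Fin d) {φ : Rd d → ℂ}
    (h : HasCompactSupport φ) : HasCompactSupport (partialD j φ) := by
  unfold partialD
  exact (h.fderiv_apply ℝ _).mul_left

theorem multiD_test {d : ℕ} (α : Fin d → ℕ) {φ : Rd d → ℂ} (h : ContDiff ℝ ∞ φ)
    (h' : HasCompactSupport φ) :
    ContDiff ℝ ∞ (multiD α φ) ∧ HasCompactSupport (multiD α φ) := by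
  unfold multiD
  induction List.finRange d with
  | nil => exact ⟨h, h'⟩
  | cons j l ih =>
    rw [List.foldr_cons]
    generalize List.foldr (fun j ψ => (partialD j)^[α j] ψ) φ l = ψ at ih
    induction α j with
    | zero => exact ih
    | succ k ihk =>
      rw [Function.iterate_succ_apply']
      exact ⟨contDiff_partialD j ihk.1, hasCompactSupport_partialD j ihk.2⟩

theorem integrable_test_smul {d : ℕ} {m : ℕ} {f : Rd d → Cm m} (hf : LocallyIntegrable f)
    {φ : Rd d → ℂ} (h : ContDiff ℝ ∞ φ) (h' : HasCompactSupport φ) :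
    Integrable (fun x => φ x • f x) :=
  hf.integrable_smul_left_of_hasCompactSupport h.continuous h'

theorem comp_fract_congr {d : ℕ} (b : Module.Basis (Fin d) ℝ (Rd d)) {m : ℕ}
    {f g : Rd d → Cm m} (h : f =ᵐ[volume.restrict (cell b)] g) :
    ∀ᵐ x : Rd d, f (ZSpan.fract b x) = g (ZSpan.fract b x) := by
  have hF : MeasurableSet (cell b) := ZSpan.fundamentalDomain_measurableSet b
  have h1 : ∀ᵐ x : Rd d, x ∈ cell b → f x = g x := (ae_restrict_iff' hF).1 h
  have h2 : ∀ w : periodLattice b, ∀ᵐ x : Rd d, x - (w : Rd d) ∈ cell b →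
      f (x - (w : Rd d)) = g (x - (w : Rd d)) := fun w =>
    (measurePreserving_sub_right (volume : Measure (Rd d)) (w : Rd d)).quasiMeasurePreserving.ae h1
  have h3 := ae_all_iff.2 h2
  filter_upwards [h3] with x hx
  exact hx (ZSpan.floor b x) (ZSpan.fract_mem_fundamentalDomain b x)

theorem quasiExt_add {d : ℕ} (b : Module.Basis (Fin d) ℝ (Rd d)) {m : ℕ} (t : Rd d)
    (u v : L2cell b m) :
    quasiExt b t (u + v) =ᵐ[volume] fun x => quasiExt b t u x + quasiExt b t v x := by
  filter_upwards [comp_fract_congr b (Lp.coeFn_add u v)] with x hx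
  simp only [quasiExt, hx, Pi.add_apply, smul_add]

theorem quasiExt_smul {d : ℕ} (b : Module.Basis (Fin d) ℝ (Rd d)) {m : ℕ} (t : Rd d)
    (c : ℂ) (u : L2cell b m) :
    quasiExt b t (c • u) =ᵐ[volume] fun x => c • quasiExt b t u x := by
  filter_upwards [comp_fract_congr b (Lp.coeFn_smul c u)] with x hx
  simp only [quasiExt, hx, Pi.smul_apply]
  rw [smul_comm]

theorem integral_smul_quasiExt_add {d : ℕ} (b : Module.Basis (Fin d) ℝ (Rd d)) {m : ℕ}
    (t : Rd d) (u v : L2cell b m) {φ : Rd d → ℂ} (h : ContDiff ℝ ∞ φ)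
    (h' : HasCompactSupport φ) :
    ∫ x, φ x • quasiExt b t (u + v) x =
      (∫ x, φ x • quasiExt b t u x) + ∫ x, φ x • quasiExt b t v x := by
  rw [← integral_add (integrable_test_smul (locallyIntegrable_quasiExt b t u) h h')
    (integrable_test_smul (locallyIntegrable_quasiExt b t v) h h')]
  refine integral_congr_ae ?_
  filter_upwards [quasiExt_add b t u v] with x hx
  rw [hx, smul_add]

theorem integral_smul_quasiExt_smul {d : ℕ} (b : Module.Basis (Fin d) ℝ (Rd d)) {m : ℕ}
    (t : Rd d) (c : ℂ) (u : L2cell b m) (φ : Rd d → ℂ) :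
    ∫ x, φ x • quasiExt b t (c • u) x = c • ∫ x, φ x • quasiExt b t u x := by
  rw [← integral_smul]
  refine integral_congr_ae ?_
  filter_upwards [quasiExt_smul b t c u] with x hx
  rw [hx, smul_comm]

theorem IsWeakD.add {d : ℕ} {b : Module.Basis (Fin d) ℝ (Rd d)} {m : ℕ} {t : Rd d}
    {α : Fin d → ℕ} {u v g h : L2cell b m} (hu : IsWeakD b t α u g) (hv : IsWeakD b t α v h) :
    IsWeakD b t α (u + v) (g + h) := by
  intro φ hφ hφ'
  obtain ⟨h1, h2⟩ := multiD_test α hφ hφ'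
  rw [integral_smul_quasiExt_add b t _ _ hφ hφ', integral_smul_quasiExt_add b t _ _ h1 h2,
    hu φ hφ hφ', hv φ hφ hφ', smul_add]

theorem IsWeakD.smul {d : ℕ} {b : Module.Basis (Fin d) ℝ (Rd d)} {m : ℕ} {t : Rd d}
    {α : Fin d → ℕ} {u g : L2cell b m} (c : ℂ) (hu : IsWeakD b t α u g) :
    IsWeakD b t α (c • u) (c • g) := by
  intro φ hφ hφ'
  rw [integral_smul_quasiExt_smul, integral_smul_quasiExt_smul, hu φ hφ hφ', smul_comm]

theorem IsWeakD.unique {d : ℕ} {b : Module.Basis (Fin d) ℝ (Rd d)} {m : ℕ} {t : Rd d}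
    {α : Fin d → ℕ} {u g h : L2cell b m} (hg : IsWeakD b t α u g) (hh : IsWeakD b t α u h) :
    g = h := by
  have hlg := locallyIntegrable_quasiExt b t g
  have hlh := locallyIntegrable_quasiExt b t h
  have key : ∀ᵐ x : Rd d, (quasiExt b t g - quasiExt b t h) x = 0 := by
    refine ae_eq_zero_of_integral_contDiff_smul_eq_zero (hlg.sub hlh) ?_
    intro φ hφ hφ'
    have hψ : ContDiff ℝ ∞ (fun x => (φ x : ℂ)) := Complex.ofRealCLM.contDiff.comp hφ
    have hψ' : HasCompactSupport (fun x => (φ x : ℂ)) :=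
      hφ'.comp_left (g := fun r : ℝ => (r : ℂ)) (by simp)
    have e := (hg _ hψ hψ').trans (hh _ hψ hψ').symm
    rw [← sub_eq_zero, ← integral_sub (integrable_test_smul hlg hψ hψ')
      (integrable_test_smul hlh hψ hψ')] at e
    rw [← e]
    refine integral_congr_ae (Filter.Eventually.of_forall fun x => ?_)
    simp only [Pi.sub_apply, smul_sub, Complex.coe_smul]
  have hF : MeasurableSet (cell b) := ZSpan.fundamentalDomain_measurableSet b
  refine Lp.ext ((ae_restrict_iff' hF).2 ?_)
  filter_upwards [key] with x hx hxF
  have hfr := (ZSpan.fract_eq_self (b := b)).2 hxF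
  rw [Pi.sub_apply, sub_eq_zero] at hx
  unfold quasiExt at hx
  rw [hfr] at hx
  exact smul_right_injective _ (Complex.exp_ne_zero _) hx

open Classical in
/-- The weak derivative `D_α u` under the quasiperiodic conditions with quasimomentum `t`
(and `0` if `u` has none in `L_2^m(F)`). -/
def weakD {d : ℕ} (b : Module.Basis (Fin d) ℝ (Rd d)) {m : ℕ} (t : Rd d) (α : Fin d → ℕ)
    (u : L2cell b m) : L2cell b m :=
  if h : ∃ g, IsWeakD b t α u g then h.choose else 0

theorem IsWeakD.weakD_eq {d : ℕ} {b : Module.Basis (Fin d) ℝ (Rd d)} {m : ℕ} {t : Rd d}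
    {α : Fin d → ℕ} {u g : L2cell b m} (h : IsWeakD b t α u g) : weakD b t α u = g := by
  have h' : ∃ g, IsWeakD b t α u g := ⟨g, h⟩
  rw [weakD, dif_pos h']
  exact h'.choose_spec.unique h

/-- The quasiperiodic Sobolev space of order `N`: all `u ∈ L_2^m(F)` satisfying the
quasiperiodic conditions with quasimomentum `t` together with their weak derivatives
`D_α u ∈ L_2^m(F)`, `|α| ≤ N`. -/
def quasiSobolev {d : ℕ} (b : Module.Basis (Fin d) ℝ (Rd d)) (m : ℕ) (t : Rd d) (N : ℕ) :
    Submodule ℂ (L2cell b m) where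
  carrier := {u | ∀ α : Fin d → ℕ, ∑ j, α j ≤ N → ∃ g, IsWeakD b t α u g}
  zero_mem' := fun α _ => ⟨0, fun φ _ _ => by
    have h0 : ∀ ψ : Rd d → ℂ, ∫ x, ψ x • quasiExt b t (0 : L2cell b m) x = 0 := fun ψ => by
      simpa using integral_smul_quasiExt_smul b t 0 (0 : L2cell b m) ψ
    rw [h0, h0, smul_zero]⟩
  add_mem' := fun hu hv α hα =>
    ⟨_, (hu α hα).choose_spec.add (hv α hα).choose_spec⟩
  smul_mem' := fun c _ hu α hα => ⟨_, (hu α hα).choose_spec.smul c⟩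

theorem weakD_add {d : ℕ} {b : Module.Basis (Fin d) ℝ (Rd d)} {m : ℕ} {t : Rd d} {N : ℕ}
    {α : Fin d → ℕ} (hα : ∑ j, α j ≤ N) {u v : L2cell b m} (hu : u ∈ quasiSobolev b m t N)
    (hv : v ∈ quasiSobolev b m t N) :
    weakD b t α (u + v) = weakD b t α u + weakD b t α v := by
  obtain ⟨g, hg⟩ := hu α hα
  obtain ⟨h, hh⟩ := hv α hα
  rw [hg.weakD_eq, hh.weakD_eq, (hg.add hh).weakD_eq]

theorem weakD_smul {d : ℕ} {b : Module.Basis (Fin d) ℝ (Rd d)} {m : ℕ} {t : Rd d} {N : ℕ}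
    {α : Fin d → ℕ} (hα : ∑ j, α j ≤ N) (c : ℂ) {u : L2cell b m}
    (hu : u ∈ quasiSobolev b m t N) :
    weakD b t α (c • u) = c • weakD b t α u := by
  obtain ⟨g, hg⟩ := hu α hα
  rw [hg.weakD_eq, (hg.smul c).weakD_eq]

/-! ## Multiplication by a bounded matrix function -/

/-- A measurable matrix function with bounded entries. -/
def IsBddMatrix {d m : ℕ} (M : Rd d → Matrix (Fin m) (Fin m) ℂ) : Prop :=
  (∀ i j, Measurable fun x => M x i j) ∧ ∃ C : ℝ, ∀ x i j, ‖M x i j‖ ≤ C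

theorem isBddMatrix_const {d m : ℕ} (M : Matrix (Fin m) (Fin m) ℂ) :
    IsBddMatrix (fun _ : Rd d => M) :=
  ⟨fun _ _ => measurable_const, ∑ i, ∑ j, ‖M i j‖, fun _ i j =>
    (Finset.single_le_sum (f := fun j => ‖M i j‖) (fun _ _ => norm_nonneg _)
      (Finset.mem_univ j)).trans
    (Finset.single_le_sum (f := fun i => ∑ j, ‖M i j‖)
      (fun _ _ => Finset.sum_nonneg fun _ _ => norm_nonneg _) (Finset.mem_univ i))⟩

theorem memLp_matVec {d m : ℕ} (b : Module.Basis (Fin d) ℝ (Rd d))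
    {M : Rd d → Matrix (Fin m) (Fin m) ℂ} (hM : IsBddMatrix M) (u : L2cell b m) :
    MemLp (fun x => (WithLp.toLp 2 (M x *ᵥ (u x).ofLp) : Cm m)) 2 (volume.restrict (cell b)) := by
  obtain ⟨hmeas, C, hC⟩ := hM
  rw [memLp_piLp_iff]
  intro i
  have hu := memLp_piLp_iff.1 (Lp.memLp u)
  simp only [Matrix.mulVec, dotProduct]
  refine memLp_finsetSum _ fun j _ => ?_
  refine (hu j).of_le_mul (c := C) ((hmeas i j).aestronglyMeasurable.mul (hu j).1) ?_
  refine Filter.Eventually.of_forall fun x => ?_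
  rw [norm_mul]
  exact mul_le_mul_of_nonneg_right (hC x i j) (norm_nonneg _)

/-- The operator `u ↦ M(x) u(x)` in `L_2^m(F)`. -/
def matMul {d m : ℕ} (b : Module.Basis (Fin d) ℝ (Rd d))
    (M : Rd d → Matrix (Fin m) (Fin m) ℂ) (hM : IsBddMatrix M) : L2cell b m →ₗ[ℂ] L2cell b m where
  toFun u := (memLp_matVec b hM u).toLp _
  map_add' u v := by
    rw [← MemLp.toLp_add, MemLp.toLp_eq_toLp_iff]
    filter_upwards [Lp.coeFn_add u v] with x hx
    rw [hx]
    simp [Matrix.mulVec_add]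
  map_smul' c u := by
    rw [RingHom.id_apply, ← MemLp.toLp_const_smul, MemLp.toLp_eq_toLp_iff]
    filter_upwards [Lp.coeFn_smul c u] with x hx
    rw [hx]
    simp [Matrix.mulVec_smul]

/-! ## The differential expression and the Bloch operators -/

/-- The finite set of multi-indices `α` with `|α| = k`. -/
abbrev multiIdx (d k : ℕ) : Finset (Fin d → ℕ) := Finset.univ.piAntidiag k

/-- The data of the expression
`Tu = ∑_{|α| = 2s} Q_α D_α u + ∑_{|α| ≤ 2s-1} Q_α(x) D_α u + B u`.
The operator `B` commutes with the shifts by `Ω`, hence it maps functions satisfying the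
quasiperiodic conditions with quasimomentum `t` to such functions; `B t` is this action, as a
bounded operator in `L_2^m(F)`. The conditions depend on `t` modulo `Γ` only, and so does `B t`.
The case of one bounded operator in `L_2^m(F)` for all `t` is the case of a constant family; more
generally `B t` may depend on `t` continuously in the operator norm. -/
structure PeriodicExpr {d : ℕ} (b : Module.Basis (Fin d) ℝ (Rd d)) (m s : ℕ) where
  /-- the constant real matrices `Q_α`, used for `|α| = 2s` -/
  lead : (Fin d → ℕ) → Matrix (Fin m) (Fin m) ℝ
  /-- the matrix functions `Q_α(x)`, used for `|α| ≤ 2s - 1` -/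
  low : (Fin d → ℕ) → Rd d → Matrix (Fin m) (Fin m) ℂ
  low_bdd : ∀ α, IsBddMatrix (low α)
  low_periodic : ∀ α, ∀ w ∈ periodLattice b, ∀ x, low α (x + w) = low α x
  /-- the bounded operator `B` on functions with quasimomentum `t` -/
  B : Rd d → (L2cell b m →L[ℂ] L2cell b m)
  B_continuous : Continuous B
  B_periodic : ∀ γ ∈ dualLattice b, ∀ t, B (γ + t) = B t

/-- The operator `T_t` generated in `L_2^m(F)` by the differential expression and the
quasiperiodic conditions `u(x + ω) = e^{i⟨t, ω⟩} u(x)`, `ω ∈ Ω`. -/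
def PeriodicExpr.bloch {d m s : ℕ} {b : Module.Basis (Fin d) ℝ (Rd d)} (T : PeriodicExpr b m s)
    (t : Rd d) : L2cell b m →ₗ.[ℂ] L2cell b m where
  domain := quasiSobolev b m t (2 * s)
  toFun :=
    { toFun := fun u =>
        (∑ α ∈ multiIdx d (2 * s),
          matMul b (fun _ => (T.lead α).map (fun r : ℝ => (r : ℂ))) (isBddMatrix_const _)
            (weakD b t α u)) +
        (∑ k ∈ Finset.range (2 * s), ∑ α ∈ multiIdx d k,
          matMul b (T.low α) (T.low_bdd α) (weakD b t α u)) +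
        T.B t u
      map_add' := by
        intro u v
        have h1 : ∀ k ≤ 2 * s, ∀ α ∈ multiIdx d k, weakD b t α ((u + v : quasiSobolev b m t (2 * s))
            : L2cell b m) = weakD b t α (u : L2cell b m) + weakD b t α (v : L2cell b m) := by
          intro k hk α hα
          exact weakD_add ((Finset.mem_piAntidiag.1 hα).1.trans_le hk) u.2 v.2
        rw [Finset.sum_congr rfl fun α hα => by rw [h1 _ le_rfl α hα, map_add],
          Finset.sum_congr rfl fun k hk => Finset.sum_congr rfl fun α hα => by
            rw [h1 k (Finset.mem_range.1 hk).le α hα, map_add]]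
        simp only [Finset.sum_add_distrib, Submodule.coe_add, map_add]
        abel
      map_smul' := by
        intro c u
        have h1 : ∀ k ≤ 2 * s, ∀ α ∈ multiIdx d k, weakD b t α ((c • u : quasiSobolev b m t (2 * s))
            : L2cell b m) = c • weakD b t α (u : L2cell b m) := by
          intro k hk α hα
          exact weakD_smul ((Finset.mem_piAntidiag.1 hα).1.trans_le hk) c u.2
        rw [Finset.sum_congr rfl fun α hα => by rw [h1 _ le_rfl α hα, map_smul],
          Finset.sum_congr rfl fun k hk => Finset.sum_congr rfl fun α hα => by
            rw [h1 k (Finset.mem_range.1 hk).le α hα, map_smul]]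
        simp only [← Finset.smul_sum, Submodule.coe_smul, map_smul, smul_add, RingHom.id_apply] }

/-! ## Below-bounded self-adjoint operators with compact resolvent -/

/-- `A ∈ SBC(H)`: `A` is self-adjoint, bounded below, and has compact resolvent. -/
def IsSBC {H : Type*} [NormedAddCommGroup H] [InnerProductSpace ℂ H] [CompleteSpace H]
    (A : H →ₗ.[ℂ] H) : Prop :=
  IsSelfAdjoint A ∧
  (∃ c : ℝ, ∀ u : A.domain, c * ‖(u : H)‖ ^ 2 ≤ (⟪(u : H), A u⟫_ℂ).re) ∧
  ∃ (z : ℂ) (R : H →L[ℂ] H), IsCompactOperator R ∧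
    (∀ f : H, ∃ h : R f ∈ A.domain, A ⟨R f, h⟩ - z • R f = f) ∧
    ∀ u : A.domain, R (A u - z • (u : H)) = u

/-- The eigenspace `{u ∈ D(A) : A u = μ u}`. -/
def eigSpace {H : Type*} [NormedAddCommGroup H] [InnerProductSpace ℂ H]
    (A : H →ₗ.[ℂ] H) (μ : ℝ) : Submodule ℂ H :=
  A.graph.comap (LinearMap.id.prod ((μ : ℂ) • LinearMap.id))

/-- The `n`-th (`n ≥ 1`) eigenvalue of `A`, in nondecreasing order and counted with multiplicity:
the least `x` such that the eigenvectors with eigenvalues `≤ x` span a space of dimension at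
least `n`. -/
def nthEig {H : Type*} [NormedAddCommGroup H] [InnerProductSpace ℂ H]
    (A : H →ₗ.[ℂ] H) (n : ℕ) : ℝ :=
  sInf {x : ℝ | (n : Cardinal) ≤ Module.rank ℂ ↥(⨆ μ : ℝ, ⨆ _ : μ ≤ x, eigSpace A μ)}

/-- `μ` is a simple eigenvalue of `A`. -/
def IsSimpleEig {H : Type*} [NormedAddCommGroup H] [InnerProductSpace ℂ H]
    (A : H →ₗ.[ℂ] H) (μ : ℝ) : Prop :=
  Module.finrank ℂ (eigSpace A μ) = 1

/-- `Ψ` is a normalized eigenfunction of `A` for the eigenvalue `μ`. -/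
def IsNormalizedEig {H : Type*} [NormedAddCommGroup H] [InnerProductSpace ℂ H]
    (A : H →ₗ.[ℂ] H) (μ : ℝ) (Ψ : H) : Prop :=
  Ψ ∈ eigSpace A μ ∧ ‖Ψ‖ = 1

/-- The `n`-th band function `t ↦ λ_n(t)`. -/
def PeriodicExpr.band {d m s : ℕ} {b : Module.Basis (Fin d) ℝ (Rd d)} (T : PeriodicExpr b m s)
    (n : ℕ) (t : Rd d) : ℝ :=
  nthEig (T.bloch t) n

/-- The assumptions on the family `T_t`, `t ∈ E`: every `T_t` belongs to `SBC(L_2^m(F))`, and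
there are `ε, c > 0` with
`‖Tu + cu - Bu‖ + ‖u‖ ≥ ε ∑_{|α| ≤ 2s-1} ‖D_α u‖` for all `u ∈ D(T_t)` and `t ∈ E`. -/
def PeriodicExpr.Admissible {d m s : ℕ} {b : Module.Basis (Fin d) ℝ (Rd d)}
    (T : PeriodicExpr b m s) (E : Set (Rd d)) : Prop :=
  (∀ t ∈ E, IsSBC (T.bloch t)) ∧
  ∃ ε : ℝ, 0 < ε ∧ ∃ c : ℝ, 0 < c ∧ ∀ t ∈ E, ∀ u : (T.bloch t).domain,
    ε * ∑ k ∈ Finset.range (2 * s), ∑ α ∈ multiIdx d k, ‖weakD b t α (u : L2cell b m)‖ ≤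
      ‖T.bloch t u + (c : ℂ) • (u : L2cell b m) - T.B t u‖ + ‖(u : L2cell b m)‖

/-- The inner product `(Ψ, e^{i⟨t,x⟩} v) = ∫_F ⟨Ψ(x), e^{i⟨t,x⟩} v⟩ dx` in `L_2^m(F)`, where
`v ∈ ℂ^m`; it is linear in `Ψ`. -/
def planeCoeff {d m : ℕ} (b : Module.Basis (Fin d) ℝ (Rd d)) (t : Rd d) (v : Cm m)
    (Ψ : L2cell b m) : ℂ :=
  ∫ x in cell b, ⟪Complex.exp (Complex.I * (⟪t, x⟫_ℝ : ℝ)) • v, Ψ x⟫_ℂ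

/-- On the set `U`: the eigenvalue `λ_n(t)` is simple, the number `|(Ψ_{n,t}, e^{i⟨t,x⟩} v)|` is
the same for all normalized eigenfunctions `Ψ_{n,t}`, and it is a continuous function of
`t ∈ U`. -/
def PeriodicExpr.ContinuousModulusOn {d m s : ℕ} {b : Module.Basis (Fin d) ℝ (Rd d)}
    (T : PeriodicExpr b m s) (n : ℕ) (U : Set (Rd d)) : Prop :=
  (∀ t ∈ U, IsSimpleEig (T.bloch t) (T.band n t)) ∧
  ∀ v : Cm m,
    (∀ t ∈ U, ∀ Ψ Ψ' : L2cell b m, IsNormalizedEig (T.bloch t) (T.band n t) Ψ →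
      IsNormalizedEig (T.bloch t) (T.band n t) Ψ' →
      ‖planeCoeff b t v Ψ‖ = ‖planeCoeff b t v Ψ'‖) ∧
    ∀ Ψ : Rd d → L2cell b m,
      (∀ t ∈ U, IsNormalizedEig (T.bloch t) (T.band n t) (Ψ t)) →
      ContinuousOn (fun t => ‖planeCoeff b t v (Ψ t)‖) U

end

/-! ### Eigenbases of self-adjoint operators with compact resolvent -/

section Spectral

variable {H : Type*} [NormedAddCommGroup H] [InnerProductSpace ℂ H]

/-! Multiplication by `e^{i⟨τ,x⟩}` is a unitary map of `L_2^m(F)` that turns quasimomentum `t` into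
`t + τ`, so all the operators `T_{t+τ}` can be compared with `T_t` despite their different domains.
It commutes with every matrix multiplication. By the Leibniz rule its commutator with `D_α` has only
derivatives of order less than `|α|`, with coefficients that vanish as `τ → 0`. Condition (A) bounds
derivatives of order at most `2s - 1` by the graph norm of `T_t`, and `B_t` is norm-continuous.
Hence the transported `T_{t+τ}` is `T_t` plus a perturbation whose relative bound tends to `0`
(`eventually_isGraphClose`).

The rest is perturbation theory for self-adjoint operators with compact resolvent, done in
eigenbases (`IsSBC.exists_eigenbasis`). A dimension count compares the numbers of eigenvalues below
shifted levels in both directions (`ncard_sublevel_le`). Since a simple `λ_n` is isolated, the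
counts leave room for exactly one nearby eigenvalue, and it again has index `n`
(`ncard_eq_one_of_interlacing`). The spectral gap then forces the new eigenvector close to a
multiple of the old one (`IsSBC.simple_stable`).

The coefficient `(Ψ, e^{i⟨t,x⟩}v)` is unchanged when `Ψ` and `t` are modulated together, so its
modulus varies continuously. Finally `T_t` depends on `t` only modulo `Γ`, which spreads (A) from
`F^⋆` to all of `ℝ^d`, and discreteness of `Γ` makes small balls extend to fundamental sets. -/

theorem mem_eigSpace_iff {A : H →ₗ.[ℂ] H} {μ : ℝ} {v : H} :
    v ∈ eigSpace A μ ↔ ∃ h : v ∈ A.domain, A ⟨v, h⟩ = (μ : ℂ) • v := by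
  unfold eigSpace
  rw [Submodule.mem_comap]
  change (v, (μ : ℂ) • v) ∈ A.graph ↔ _
  rw [LinearPMap.mem_graph_iff]
  constructor
  · rintro ⟨y, rfl, hy⟩
    exact ⟨y.2, hy⟩
  · rintro ⟨h, hv⟩
    exact ⟨⟨v, h⟩, rfl, hv⟩

theorem IsSelfAdjoint.inner_linearPMap [CompleteSpace H] {A : H →ₗ.[ℂ] H} (hA : IsSelfAdjoint A)
    (u v : A.domain) : ⟪A u, (v : H)⟫_ℂ = ⟪(u : H), A v⟫_ℂ := by
  have h := LinearPMap.adjoint_isFormalAdjoint hA.dense_domain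
  rw [LinearPMap.isSelfAdjoint_def.1 hA] at h
  exact h u v

theorem inner_eigSpace_apply [CompleteSpace H] {A : H →ₗ.[ℂ] H} (hA : IsSelfAdjoint A) {μ : ℝ} {v : H}
    (hv : v ∈ eigSpace A μ) (u : A.domain) : ⟪v, A u⟫_ℂ = μ * ⟪v, (u : H)⟫_ℂ := by
  obtain ⟨h, hv'⟩ := mem_eigSpace_iff.1 hv
  rw [← hA.inner_linearPMap ⟨v, h⟩ u, hv', inner_smul_left, Complex.conj_ofReal]

theorem orthogonalFamily_eigSpace [CompleteSpace H] {A : H →ₗ.[ℂ] H} (hA : IsSelfAdjoint A) :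
    OrthogonalFamily ℂ (fun μ : ℝ => eigSpace A μ) fun μ => (eigSpace A μ).subtypeₗᵢ := by
  rintro μ ν hμν ⟨v, hv⟩ ⟨w, hw⟩
  obtain ⟨h, hw'⟩ := mem_eigSpace_iff.1 hw
  have h1 := inner_eigSpace_apply hA hv ⟨w, h⟩
  rw [hw', inner_smul_right] at h1
  have h2 : ((ν : ℂ) - μ) * ⟪v, w⟫_ℂ = 0 := by linear_combination h1
  rcases mul_eq_zero.1 h2 with h3 | h3
  · exact absurd (by exact_mod_cast (sub_eq_zero.1 h3).symm) hμν
  · exact h3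

/-- If `k` is not an eigenvalue, the compact resolvent exists at `k`. -/
theorem exists_compact_resolvent [CompleteSpace H] {A : H →ₗ.[ℂ] H} {z : ℂ} {R : H →L[ℂ] H}
    (hR : IsCompactOperator R) (hAR : ∀ f : H, ∃ h : R f ∈ A.domain, A ⟨R f, h⟩ - z • R f = f)
    {k : ℂ} (hk : ∀ u : A.domain, A u = k • (u : H) → (u : H) = 0) :
    ∃ S : H →L[ℂ] H, IsCompactOperator S ∧
      (∀ f : H, ∃ h : S f ∈ A.domain, A ⟨S f, h⟩ - k • S f = f) := by
  by_cases hkz : k = z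
  · subst hkz
    exact ⟨R, hR, hAR⟩
  have hne : k - z ≠ 0 := sub_ne_zero.2 hkz
  -- Fredholm alternative: an eigenvector `f` of `R` for `(k - z)⁻¹` would give `A R f = k R f` with
  -- `R f ≠ 0`.
  have hres : (k - z)⁻¹ ∈ resolventSet ℂ R := by
    refine (hR.hasEigenvalue_or_mem_resolventSet (inv_ne_zero hne)).resolve_left fun hev => ?_
    obtain ⟨f, hf, hf0⟩ := hev.exists_hasEigenvector
    rw [Module.End.mem_eigenspace_iff] at hf
    have hf' : R f = (k - z)⁻¹ • f := hf
    obtain ⟨h, hAf⟩ := hAR f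
    have h1 : f = (k - z) • R f := by rw [hf', smul_inv_smul₀ hne]
    have h2 : A ⟨R f, h⟩ = k • R f := by
      rw [sub_eq_iff_eq_add.1 hAf]
      nth_rewrite 1 [h1]
      rw [← add_smul, sub_add_cancel]
    have h3 : R f = 0 := hk _ h2
    rw [h3, smul_zero] at h1
    exact hf0 h1
  obtain ⟨U, hU⟩ := hres
  -- With `U = (k - z)⁻¹ - R` this is the resolvent identity `S = R (1 - (k - z) R)⁻¹`.
  refine ⟨R ∘L ((k - z)⁻¹ • (U⁻¹ : (H →L[ℂ] H)ˣ).val), hR.comp_clm _, fun f => ?_⟩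
  set g : H := (k - z)⁻¹ • (U⁻¹ : (H →L[ℂ] H)ˣ).val f with hg
  obtain ⟨h, hAg⟩ := hAR g
  refine ⟨h, ?_⟩
  change A ⟨R g, h⟩ - k • R g = f
  have h1 : (k - z)⁻¹ • g - R g = (k - z)⁻¹ • f := by
    have h2 : ((U.val : H →L[ℂ] H) * U⁻¹.val) f = f := by rw [Units.mul_inv]; rfl
    rw [mul_apply_eq_comp, hU, sub_apply,
      ContinuousLinearMap.algebraMap_apply] at h2
    conv_rhs => rw [← h2]
    rw [hg, map_smul, smul_sub]
  calc A ⟨R g, h⟩ - k • R g = (A ⟨R g, h⟩ - z • R g) - (k - z) • R g := by rw [sub_smul]; abel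
    _ = (k - z) • ((k - z)⁻¹ • g - R g) := by rw [hAg, smul_sub, smul_inv_smul₀ hne]
    _ = f := by rw [h1, smul_inv_smul₀ hne]

/-- A Hilbert basis of eigenvectors of `A` whose eigenvalues tend to `+∞`. -/
structure IsEigenbasis (A : H →ₗ.[ℂ] H) {ι : Type} (e : HilbertBasis ι ℂ H) (lam : ι → ℝ) :
    Prop where
  mem : ∀ i, e i ∈ eigSpace A (lam i)
  inner_apply : ∀ i (u : A.domain), ⟪e i, A u⟫_ℂ = lam i * ⟪e i, (u : H)⟫_ℂ
  finite : ∀ x, {i | lam i ≤ x}.Finite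

/-- Cauchy–Schwarz applied to `⟪u, (A - x) u⟫`. It makes `A - x` injective for `x < c`, and at an
eigenvector for `x` the right side vanishes, which gives `c ≤ x`. -/
theorem norm_sub_smul_ge_of_lower {A : H →ₗ.[ℂ] H} {c : ℝ}
    (hc : ∀ u : A.domain, c * ‖(u : H)‖ ^ 2 ≤ (⟪(u : H), A u⟫_ℂ).re) (x : ℝ) (u : A.domain) :
    (c - x) * ‖(u : H)‖ ≤ ‖A u - (x : ℂ) • (u : H)‖ := by
  rcases eq_or_ne (u : H) 0 with h0 | h0
  · simp [h0]
  have h1 : (⟪(u : H), A u - (x : ℂ) • (u : H)⟫_ℂ).re =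
      (⟪(u : H), A u⟫_ℂ).re - x * ‖(u : H)‖ ^ 2 := by
    rw [inner_sub_right, inner_smul_right, inner_self_eq_norm_sq_to_K, Complex.sub_re,
      Complex.re_ofReal_mul]
    norm_cast
  have h2 : (⟪(u : H), A u - (x : ℂ) • (u : H)⟫_ℂ).re ≤
      ‖(u : H)‖ * ‖A u - (x : ℂ) • (u : H)‖ :=
    (Complex.re_le_norm _).trans (norm_inner_le_norm _ _)
  have h3 := hc u
  have h4 : 0 < ‖(u : H)‖ := norm_pos_iff.2 h0
  refine le_of_mul_le_mul_left ?_ h4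
  nlinarith

/-- The spectral theorem for the compact symmetric operator `S = (A - k)⁻¹`, with `k` real and below
the spectrum: an eigenvalue `r` of `S` corresponds to `k + 1/r` for `A`. Infinitely many basis
vectors with eigenvalue at most `x` would have images under `S` at mutual distance at least `(x -
k)⁻¹`, against compactness. -/
theorem IsSBC.exists_eigenbasis [CompleteSpace H] {A : H →ₗ.[ℂ] H} (hA : IsSBC A) :
    ∃ (ι : Type) (e : HilbertBasis ι ℂ H) (lam : ι → ℝ), IsEigenbasis A e lam := by
  obtain ⟨hsa, ⟨c, hc⟩, z, R, hR, hAR, -⟩ := hA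
  -- Being one unit below the lower bound gives `‖(A - k) u‖ ≥ ‖u‖`; being real makes `S` symmetric.
  obtain ⟨k, hck⟩ : ∃ k : ℝ, k = c - 1 := ⟨_, rfl⟩
  have hlow : ∀ u : A.domain, ‖(u : H)‖ ≤ ‖A u - (k : ℂ) • (u : H)‖ := fun u => by
    simpa [hck] using norm_sub_smul_ge_of_lower hc k u
  have hk : ∀ u : A.domain, A u = (k : ℂ) • (u : H) → (u : H) = 0 := fun u hu => by
    simpa [hu] using hlow u
  obtain ⟨S, hS, hAS⟩ := exists_compact_resolvent hR hAR hk
  have hSA : ∀ u : A.domain, S (A u - (k : ℂ) • (u : H)) = u := fun u => by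
    obtain ⟨h, h'⟩ := hAS (A u - (k : ℂ) • (u : H))
    have h1 := hk (⟨_, h⟩ - u) (by
      rw [LinearPMap.map_sub, Submodule.coe_sub, smul_sub]
      exact sub_eq_sub_iff_sub_eq_sub.1 h')
    rwa [Submodule.coe_sub, sub_eq_zero] at h1
  have hsymm : S.IsSymmetric := by
    intro f g
    obtain ⟨hf, hf'⟩ := hAS f
    obtain ⟨hg, hg'⟩ := hAS g
    have h1 := hsa.inner_linearPMap ⟨_, hf⟩ ⟨_, hg⟩
    change ⟪S f, g⟫_ℂ = ⟪f, S g⟫_ℂ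
    nth_rewrite 1 [← hg']
    nth_rewrite 2 [← hf']
    rw [inner_sub_left, inner_sub_right, inner_smul_left, inner_smul_right, Complex.conj_ofReal, h1]
  -- eigenvectors of the resolvent and of the operator
  have hSe : ∀ {ν : ℝ} {v : H}, v ∈ eigSpace A ν → ((ν : ℂ) - k) • S v = v := by
    intro ν v hv
    obtain ⟨h, hv'⟩ := mem_eigSpace_iff.1 hv
    have h1 := hSA ⟨v, h⟩
    rw [hv', ← sub_smul, map_smul] at h1
    exact h1
  have hle : (⨆ μ : ℂ, Module.End.eigenspace (S : Module.End ℂ H) μ) ≤ ⨆ ν : ℝ, eigSpace A ν := by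
    refine iSup_le fun μ v hv => ?_
    rcases eq_or_ne v 0 with rfl | hv0
    · exact zero_mem _
    have hev : Module.End.HasEigenvalue (S : Module.End ℂ H) μ :=
      Module.End.hasEigenvalue_of_hasEigenvector ⟨hv, hv0⟩
    have hreal := hsymm.conj_eigenvalue_eq_self hev
    obtain ⟨r, rfl⟩ := Complex.conj_eq_iff_real.1 hreal
    have hv1 : S v = (r : ℂ) • v := Module.End.mem_eigenspace_iff.1 hv
    obtain ⟨h, hv2⟩ := hAS v
    have hr : (r : ℂ) ≠ 0 := by
      rintro h0
      have hz : (⟨S v, h⟩ : A.domain) = 0 := Subtype.ext (by simp [hv1, h0])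
      rw [hz, LinearPMap.map_zero, hv1, h0] at hv2
      exact hv0 (by simpa using hv2.symm)
    have hmem : v ∈ A.domain := by
      have h3 := A.domain.smul_mem ((r : ℂ)⁻¹) h
      rwa [hv1, inv_smul_smul₀ hr] at h3
    refine Submodule.mem_iSup_of_mem (k + r⁻¹) (mem_eigSpace_iff.2 ⟨hmem, ?_⟩)
    have h4 : (⟨S v, h⟩ : A.domain) = (r : ℂ) • ⟨v, hmem⟩ := Subtype.ext hv1
    rw [h4, LinearPMap.map_smul, hv1] at hv2
    refine smul_right_injective H hr ?_
    simp only
    rw [sub_eq_iff_eq_add.1 hv2, smul_smul]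
    push_cast
    rw [smul_smul, mul_add, mul_inv_cancel₀ hr, add_smul, one_smul, add_comm, mul_comm]
  have hbot : (⨆ ν : ℝ, eigSpace A ν)ᗮ = ⊥ :=
    le_bot_iff.1 ((Submodule.orthogonal_le hle).trans
      (S.orthogonalComplement_iSup_eigenspaces_eq_bot hS hsymm).le)
  have hfin : ∀ ν : ℝ, FiniteDimensional ℂ (eigSpace A ν) := by
    intro ν
    by_cases hν : (ν : ℂ) - k = 0
    · have : eigSpace A ν = ⊥ := (Submodule.eq_bot_iff _).2 fun v hv => by
        rw [← hSe hv, hν, zero_smul]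
      rw [this]
      infer_instance
    · have h1 : eigSpace A ν ≤ Module.End.eigenspace (S : Module.End ℂ H) ((ν : ℂ) - k)⁻¹ := by
        intro v hv
        rw [Module.End.mem_eigenspace_iff]
        refine smul_right_injective H hν ?_
        simp only
        rw [smul_inv_smul₀ hν]
        exact hSe hv
      have h2 := S.finite_dimensional_eigenspace hS _ (inv_ne_zero hν)
      exact Submodule.finiteDimensional_of_le h1
  have hon := (orthogonalFamily_eigSpace hsa).orthonormal_sigma_orthonormal
    (fun ν => (stdOrthonormalBasis ℂ (eigSpace A ν)).orthonormal)
  set e : (Σ ν : ℝ, Fin (Module.finrank ℂ (eigSpace A ν))) → H :=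
    fun a => (eigSpace A a.1).subtypeₗᵢ (stdOrthonormalBasis ℂ (eigSpace A a.1) a.2) with he
  have hspan : (Submodule.span ℂ (Set.range e))ᗮ = ⊥ := by
    refine le_bot_iff.1 ((Submodule.orthogonal_le ?_).trans hbot.le)
    refine iSup_le fun ν v hv => ?_
    have h1 := (stdOrthonormalBasis ℂ (eigSpace A ν)).sum_repr ⟨v, hv⟩
    have h2 := congrArg (fun w : eigSpace A ν => (w : H)) h1
    simp only [Submodule.coe_sum, Submodule.coe_smul] at h2
    rw [← h2]
    exact Submodule.sum_mem _ fun i _ => Submodule.smul_mem _ _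
      (Submodule.subset_span ⟨⟨ν, i⟩, rfl⟩)
  have hmem : ∀ a, e a ∈ eigSpace A a.1 := fun a =>
    (stdOrthonormalBasis ℂ (eigSpace A a.1) a.2).2
  have hcoe : ⇑(HilbertBasis.mkOfOrthogonalEqBot hon hspan) = e :=
    HilbertBasis.coe_mkOfOrthogonalEqBot hon hspan
  refine ⟨_, HilbertBasis.mkOfOrthogonalEqBot hon hspan, Sigma.fst, ?_, ?_, ?_⟩
  · intro i
    rw [hcoe]
    exact hmem i
  · intro i u
    rw [hcoe]
    exact inner_eigSpace_apply hsa (hmem i) u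
  · intro x
    by_contra hinf
    have hinf' : {i : (Σ ν : ℝ, Fin (Module.finrank ℂ (eigSpace A ν))) | i.1 ≤ x}.Infinite := hinf
    have := hinf'.to_subtype
    set f := Infinite.natEmbedding {i : (Σ ν : ℝ, Fin (Module.finrank ℂ (eigSpace A ν))) | i.1 ≤ x}
    obtain ⟨K, hK, hKS⟩ := hS.image_closedBall_subset_compact (𝕜₁ := ℂ) 1
    have hfK : ∀ n, S (e (f n)) ∈ K := fun n => hKS ⟨_, by
      rw [mem_closedBall_zero_iff]; exact (hon.1 _).le, rfl⟩
    obtain ⟨y, -, φ, hφ, hlim⟩ := hK.tendsto_subseq hfK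
    have hcau := hlim.cauchySeq
    have hge : ∀ a : (Σ ν : ℝ, Fin (Module.finrank ℂ (eigSpace A ν))), 1 ≤ a.1 - k := fun a => by
      obtain ⟨h, hv'⟩ := mem_eigSpace_iff.1 (hmem a)
      have h2 := norm_sub_smul_ge_of_lower hc a.1 ⟨_, h⟩
      rw [hv', sub_self, norm_zero] at h2
      have h3 : ‖e a‖ = 1 := hon.1 a
      simp only [h3] at h2
      linarith
    -- Pairing the difference with `e a` removes the `e b` term and leaves `(a.1 - k)⁻¹`.
    have hsep : ∀ a b, a ≠ b → a.1 ≤ x → (x - k)⁻¹ ≤ dist (S (e a)) (S (e b)) := by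
      intro a b hab hax
      have hpos : 0 < a.1 - k := by linarith [hge a]
      have h1 : ⟪e a, S (e a) - S (e b)⟫_ℂ = ((a.1 - k : ℝ) : ℂ)⁻¹ := by
        have hne : ∀ a : (Σ ν : ℝ, Fin (Module.finrank ℂ (eigSpace A ν))), ((a.1 : ℂ) - k) ≠ 0 := by
          intro a h0
          have : a.1 - k = 0 := by exact_mod_cast h0
          linarith [hge a]
        have hS' : ∀ a, S (e a) = ((a.1 : ℂ) - k)⁻¹ • e a := fun a => by
          refine smul_right_injective H (hne a) ?_
          simp only
          rw [smul_inv_smul₀ (hne a)]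
          exact hSe (hmem a)
        rw [inner_sub_right, hS', hS', inner_smul_right, inner_smul_right, hon.2 hab,
          inner_self_eq_norm_sq_to_K, show ‖e a‖ = 1 from hon.1 a]
        simp
      have h2 := norm_inner_le_norm (𝕜 := ℂ) (e a) (S (e a) - S (e b))
      rw [h1, show ‖e a‖ = 1 from hon.1 a, one_mul, norm_inv, Complex.norm_real,
        Real.norm_of_nonneg hpos.le] at h2
      rw [dist_eq_norm]
      exact (inv_anti₀ hpos (by linarith)).trans h2
    have hpos : 0 < (x - k)⁻¹ := inv_pos.2 (by linarith [hge (f 0), (f 0).2.out])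
    obtain ⟨N, hN⟩ := Metric.cauchySeq_iff'.1 hcau _ hpos
    have h1 := hN (N + 1) (Nat.le_succ N)
    have hne : (f (φ (N + 1))).1 ≠ (f (φ N)).1 := fun h =>
      absurd (hφ.injective (f.injective (Subtype.ext h))) (by omega)
    exact absurd (hsep _ _ hne (f (φ (N + 1))).2) (not_le.2 h1)

end Spectral

/-! ### Order statistics of a discrete family of reals -/

section Counting

variable {ι : Type*} {lam : ι → ℝ}

/-- The `n`-th smallest member of the family `lam`. -/
noncomputable def nthSmallest (lam : ι → ℝ) (n : ℕ) : ℝ := sInf {x | n ≤ {i | lam i ≤ x}.ncard}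

theorem ncard_sublevel_mono (hfin : ∀ x, {i | lam i ≤ x}.Finite) {x y : ℝ} (h : x ≤ y) :
    {i | lam i ≤ x}.ncard ≤ {i | lam i ≤ y}.ncard :=
  Set.ncard_le_ncard (fun _ hi => le_trans hi h) (hfin y)

/-- Only finitely many members are at most `l + 1`; all others are farther than `1` from `l`. -/
theorem exists_gap (hfin : ∀ x, {i | lam i ≤ x}.Finite) (l : ℝ) :
    ∃ g : ℝ, 0 < g ∧ ∀ i, lam i ≠ l → g ≤ |lam i - l| := by
  have h1 : ((fun i => |lam i - l|) '' {i | lam i ≤ l + 1 ∧ lam i ≠ l}).Finite :=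
    ((hfin (l + 1)).subset fun i hi => hi.1).image _
  have h2 : ∀ᶠ g : ℝ in nhdsWithin 0 (Set.Ioi 0), ∀ y ∈
      ((fun i => |lam i - l|) '' {i | lam i ≤ l + 1 ∧ lam i ≠ l}), g ≤ y := by
    rw [h1.eventually_all]
    rintro y ⟨i, hi, rfl⟩
    have : 0 < |lam i - l| := abs_pos.2 (sub_ne_zero.2 hi.2)
    exact nhdsWithin_le_nhds ((gt_mem_nhds this).mono fun _ h => le_of_lt h)
  have h3 : ∀ᶠ g : ℝ in nhdsWithin 0 (Set.Ioi 0), g ≤ 1 :=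
    nhdsWithin_le_nhds ((gt_mem_nhds one_pos).mono fun _ h => le_of_lt h)
  obtain ⟨g, hg, hg1, hg0⟩ := (h2.and (h3.and self_mem_nhdsWithin)).exists
  refine ⟨g, hg0, fun i hi => ?_⟩
  rcases le_or_gt (lam i) (l + 1) with h | h
  · exact hg _ ⟨i, ⟨h, hi⟩, rfl⟩
  · exact hg1.trans (le_trans (by linarith) (le_abs_self _))

theorem exists_le_ncard_sublevel [Infinite ι] (hfin : ∀ x, {i | lam i ≤ x}.Finite) (n : ℕ) :
    ∃ x, n ≤ {i | lam i ≤ x}.ncard := by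
  obtain ⟨s, hs⟩ := Infinite.exists_subset_card_eq ι n
  obtain ⟨x, hx⟩ := (s.image lam).bddAbove
  refine ⟨x, hs ▸ ?_⟩
  rw [← Set.ncard_coe_finset]
  exact Set.ncard_le_ncard (fun i hi => hx (Finset.mem_coe.2 (Finset.mem_image_of_mem _ hi)))
    (hfin x)

/-- The infimum defining `nthSmallest` is attained, since by the gap the counting function is
constant just to the right of it. For `n = 0` the set would be all of `ℝ` and `sInf` would take its
default value, so `1 ≤ n` is essential. -/
theorem le_ncard_sublevel_iff [Infinite ι] (hfin : ∀ x, {i | lam i ≤ x}.Finite)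
    {c : ℝ} (hc : ∀ i, c ≤ lam i) {n : ℕ} (hn : 1 ≤ n) (x : ℝ) :
    n ≤ {i | lam i ≤ x}.ncard ↔ nthSmallest lam n ≤ x := by
  have hbdd : BddBelow {x | n ≤ {i | lam i ≤ x}.ncard} := by
    refine ⟨c, fun y hy => ?_⟩
    have h1 : 0 < {i | lam i ≤ y}.ncard := lt_of_lt_of_le hn hy
    obtain ⟨i, hi⟩ := (Set.ncard_pos (hfin y)).1 h1
    exact (hc i).trans hi
  refine ⟨fun h => csInf_le hbdd h, fun h => ?_⟩
  refine le_trans ?_ (ncard_sublevel_mono hfin h)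
  obtain ⟨g, hg, hgap⟩ := exists_gap hfin (nthSmallest lam n)
  obtain ⟨y, hy, hyl⟩ := exists_lt_of_csInf_lt (s := {x | n ≤ {i | lam i ≤ x}.ncard})
    (exists_le_ncard_sublevel hfin n) (show sInf _ < nthSmallest lam n + g from
      lt_add_of_pos_right _ hg)
  refine le_trans hy (Set.ncard_le_ncard (fun i hi => ?_) (hfin _))
  by_contra hlt
  have hlt' : nthSmallest lam n < lam i := not_le.1 hlt
  have h1 := hgap i hlt'.ne'
  rw [abs_of_pos (sub_pos.2 hlt')] at h1
  have h2 : lam i ≤ y := hi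
  linarith

/-- Otherwise the gap would leave `n` members already below `nthSmallest lam n - g`. -/
theorem exists_eq_nthSmallest [Infinite ι] (hfin : ∀ x, {i | lam i ≤ x}.Finite)
    {c : ℝ} (hc : ∀ i, c ≤ lam i) {n : ℕ} (hn : 1 ≤ n) : ∃ i, lam i = nthSmallest lam n := by
  by_contra! hne
  obtain ⟨g, hg, hgap⟩ := exists_gap hfin (nthSmallest lam n)
  have h1 := (le_ncard_sublevel_iff hfin hc hn _).2 le_rfl
  have h2 : n ≤ {i | lam i ≤ nthSmallest lam n - g}.ncard := by
    refine h1.trans (Set.ncard_le_ncard (fun i hi => ?_) (hfin _))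
    have h3 : lam i < nthSmallest lam n := lt_of_le_of_ne hi (hne i)
    have h4 := hgap i (hne i)
    rw [abs_of_neg (sub_neg.2 h3)] at h4
    change lam i ≤ _
    linarith
  have := (le_ncard_sublevel_iff hfin hc hn _).1 h2
  linarith

/-- Let `p` members of `lam` lie at or below `l - 2η`; by the gap and simplicity, `p + 1` lie at or
below `l`, and equally at or below `l + 2η`. Then `h2` and `h3` leave at most one member of `lam'`
in `(l - η, l + η]`, while `h1` and `h4` put the `n`-th member there. The smaller shift `η / 2` in
`h4` keeps its level strictly below `l`, where fewer than `n` members of `lam` are found. -/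
theorem ncard_eq_one_of_interlacing {ι' : Type*} [Infinite ι] [Infinite ι'] {lam' : ι' → ℝ}
    (hfin : ∀ x, {i | lam i ≤ x}.Finite) (hfin' : ∀ x, {i | lam' i ≤ x}.Finite)
    {c c' : ℝ} (hc : ∀ i, c ≤ lam i) (hc' : ∀ i, c' ≤ lam' i) {n : ℕ} (hn : 1 ≤ n)
    {l η : ℝ} (hl : l = nthSmallest lam n) (hη : 0 < η) (hsimple : {i | lam i = l}.ncard = 1)
    (hgap : ∀ i, lam i ≠ l → 3 * η ≤ |lam i - l|)
    (h1 : {i | lam i ≤ l}.ncard ≤ {i | lam' i ≤ l + η}.ncard)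
    (h2 : {i | lam' i ≤ l + η}.ncard ≤ {i | lam i ≤ l + η + η}.ncard)
    (h3 : {i | lam i ≤ l - η - η}.ncard ≤ {i | lam' i ≤ l - η - η + η}.ncard)
    (h4 : {i | lam' i ≤ l - η}.ncard ≤ {i | lam i ≤ l - η + η / 2}.ncard) :
    {i | lam' i = nthSmallest lam' n}.ncard = 1 ∧ |nthSmallest lam' n - l| ≤ η := by
  have hA := fun x => le_ncard_sublevel_iff hfin hc hn x
  have hB := fun x => le_ncard_sublevel_iff hfin' hc' hn x
  rw [← hl] at hA
  rw [show l - η - η + η = l - η by ring] at h3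
  have hup : {i | lam i ≤ l + η + η} = {i | lam i ≤ l} := by
    ext i
    refine ⟨fun hi => ?_, fun hi => ?_⟩
    · by_contra hlt
      have hlt' : l < lam i := not_le.1 hlt
      have := hgap i hlt'.ne'
      rw [abs_of_pos (sub_pos.2 hlt')] at this
      have hi' : lam i ≤ l + η + η := hi
      linarith
    · have hi' : lam i ≤ l := hi
      change lam i ≤ _
      linarith
  have hun : {i | lam i ≤ l} = {i | lam i ≤ l - η - η} ∪ {i | lam i = l} := by
    ext i
    simp only [Set.mem_union, Set.mem_ofPred_eq]
    refine ⟨fun hi => ?_, fun hi => ?_⟩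
    · rcases eq_or_lt_of_le hi with h | h
      · exact Or.inr h
      · have := hgap i h.ne
        rw [abs_of_neg (sub_neg.2 h)] at this
        left; linarith
    · rcases hi with hi | hi <;> linarith
  have hdis : Disjoint {i | lam i ≤ l - η - η} {i | lam i = l} := by
    refine Set.disjoint_left.2 fun i hi hi' => ?_
    have h5 : lam i ≤ l - η - η := hi
    have h6 : lam i = l := hi'
    linarith
  have hcard : {i | lam i ≤ l}.ncard = {i | lam i ≤ l - η - η}.ncard + 1 := by
    rw [hun, Set.ncard_union_eq hdis (hfin _)
      ((hfin l).subset fun i hi => le_of_eq hi), hsimple]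
  have e1 : n ≤ {i | lam i ≤ l}.ncard := (hA l).2 le_rfl
  have e2 : ¬ n ≤ {i | lam i ≤ l - η - η}.ncard := fun h => by linarith [(hA _).1 h]
  have e3 : ¬ n ≤ {i | lam i ≤ l - η + η / 2}.ncard := fun h => by linarith [(hA _).1 h]
  rw [hup] at h2
  have f1 : nthSmallest lam' n ≤ l + η := (hB _).1 (e1.trans h1)
  have f2 : l - η < nthSmallest lam' n := by
    by_contra hcon
    exact e3 (((hB _).2 (not_lt.1 hcon)).trans h4)
  refine ⟨?_, by rw [abs_le]; constructor <;> linarith⟩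
  have hsub : {i | lam' i = nthSmallest lam' n} ∪ {i | lam' i ≤ l - η} ⊆ {i | lam' i ≤ l + η} := by
    rintro i (hi | hi)
    · have hi' : lam' i = nthSmallest lam' n := hi
      change lam' i ≤ _
      linarith
    · have hi' : lam' i ≤ l - η := hi
      change lam' i ≤ _
      linarith
  have hdis' : Disjoint {i | lam' i = nthSmallest lam' n} {i | lam' i ≤ l - η} := by
    refine Set.disjoint_left.2 fun i hi hi' => ?_
    have h5 : lam' i ≤ l - η := hi'
    have h6 : lam' i = nthSmallest lam' n := hi
    linarith
  have hf := (hfin' (nthSmallest lam' n)).subset fun i (hi : lam' i = _) => le_of_eq hi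
  have h7 := Set.ncard_le_ncard hsub (hfin' _)
  rw [Set.ncard_union_eq hdis' hf (hfin' _)] at h7
  have h8 : 0 < {i | lam' i = nthSmallest lam' n}.ncard :=
    (Set.ncard_pos hf).2 (exists_eq_nthSmallest hfin' hc' hn)
  omega

end Counting

/-! ### Counting and norm estimates in an eigenbasis -/

section Eigenbasis

variable {H : Type*} [NormedAddCommGroup H] [InnerProductSpace ℂ H]
  {A : H →ₗ.[ℂ] H} {ι : Type} {e : HilbertBasis ι ℂ H} {lam : ι → ℝ}

theorem HilbertBasis.hasSum_norm_inner_sq (e : HilbertBasis ι ℂ H) (v : H) :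
    HasSum (fun i => ‖⟪e i, v⟫_ℂ‖ ^ 2) (‖v‖ ^ 2) := by
  have h := Complex.hasSum_re (e.hasSum_inner_mul_inner v v)
  rw [inner_self_eq_norm_sq_to_K] at h
  convert h using 1
  · ext i
    rw [← inner_conj_symm v (e i), Complex.conj_mul']
    norm_cast
  · norm_cast

theorem HilbertBasis.mem_span_of_inner_eq_zero (e : HilbertBasis ι ℂ H) {s : Set ι}
    (hs : s.Finite) {v : H} (hv : ∀ i, i ∉ s → ⟪e i, v⟫_ℂ = 0) :
    v ∈ Submodule.span ℂ (e '' s) := by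
  have h := e.hasSum_repr v
  have h1 : HasSum (fun i => e.repr v i • e i) (∑ i ∈ hs.toFinset, e.repr v i • e i) :=
    hasSum_sum_of_ne_finset_zero fun i hi => by
      rw [e.repr_apply_apply, hv i (by simpa using hi), zero_smul]
  rw [h.unique h1]
  exact Submodule.sum_mem _ fun i hi => Submodule.smul_mem _ _
    (Submodule.subset_span ⟨i, by simpa using hi, rfl⟩)

theorem HilbertBasis.inner_eq_zero_of_mem_span (e : HilbertBasis ι ℂ H) {s : Set ι}
    {v : H} (hv : v ∈ Submodule.span ℂ (e '' s)) {i : ι} (hi : i ∉ s) : ⟪e i, v⟫_ℂ = 0 := by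
  induction hv using Submodule.span_induction with
  | mem x hx =>
    obtain ⟨j, hj, rfl⟩ := hx
    exact e.orthonormal.2 fun h => hi (h ▸ hj)
  | zero => simp
  | add x y _ _ hx hy => rw [inner_add_right, hx, hy, add_zero]
  | smul a x _ hx => rw [inner_smul_right, hx, mul_zero]

theorem HilbertBasis.finrank_span_image (e : HilbertBasis ι ℂ H) {s : Set ι} (hs : s.Finite) :
    Module.finrank ℂ (Submodule.span ℂ (e '' s)) = s.ncard := by
  have := hs.fintype
  have h := e.orthonormal.linearIndependent.comp _ (Subtype.val_injective (p := (· ∈ s)))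
  rw [Set.image_eq_range, Set.ncard_eq_toFinset_card', Set.toFinset_card]
  exact finrank_span_eq_card h

namespace IsEigenbasis

theorem inner_eq_zero (hA : IsEigenbasis A e lam) {μ : ℝ} {v : H} (hv : v ∈ eigSpace A μ) {i : ι} (hi : lam i ≠ μ) :
    ⟪e i, v⟫_ℂ = 0 := by
  obtain ⟨h, hv'⟩ := mem_eigSpace_iff.1 hv
  have h1 := hA.inner_apply i ⟨v, h⟩
  rw [hv', inner_smul_right] at h1
  have h2 : ((lam i : ℂ) - μ) * ⟪e i, v⟫_ℂ = 0 := by linear_combination -h1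
  refine (mul_eq_zero.1 h2).resolve_left fun h3 => hi ?_
  exact_mod_cast sub_eq_zero.1 h3

theorem finite_eq (hA : IsEigenbasis A e lam) (μ : ℝ) : {i | lam i = μ}.Finite :=
  (hA.finite μ).subset fun _ hi => le_of_eq hi

theorem eigSpace_eq_span (hA : IsEigenbasis A e lam) (μ : ℝ) : eigSpace A μ = Submodule.span ℂ (e '' {i | lam i = μ}) := by
  refine le_antisymm (fun v hv => e.mem_span_of_inner_eq_zero (hA.finite_eq μ) fun i hi =>
    hA.inner_eq_zero hv hi) (Submodule.span_le.2 ?_)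
  rintro _ ⟨i, rfl, rfl⟩
  exact hA.mem i

theorem iSup_eigSpace_eq_span (hA : IsEigenbasis A e lam) (x : ℝ) :
    (⨆ μ : ℝ, ⨆ _ : μ ≤ x, eigSpace A μ) = Submodule.span ℂ (e '' {i | lam i ≤ x}) := by
  refine le_antisymm (iSup₂_le fun μ hμ v hv => e.mem_span_of_inner_eq_zero (hA.finite x)
    fun i hi => hA.inner_eq_zero hv ?_) (Submodule.span_le.2 ?_)
  · rintro rfl
    exact hi hμ
  · rintro _ ⟨i, hi, rfl⟩
    exact Submodule.mem_iSup_of_mem (lam i) (Submodule.mem_iSup_of_mem hi (hA.mem i))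

/-- The spectral subspace below `x` is spanned by finitely many basis vectors, so the cardinal rank
in `nthEig` is the counting function of `lam`. -/
theorem nthEig_eq (hA : IsEigenbasis A e lam) (n : ℕ) : nthEig A n = nthSmallest lam n := by
  unfold nthEig nthSmallest
  congr 1
  ext x
  rw [Set.mem_ofPred_eq, Set.mem_ofPred_eq, hA.iSup_eigSpace_eq_span x]
  have : FiniteDimensional ℂ (Submodule.span ℂ (e '' {i | lam i ≤ x})) :=
    FiniteDimensional.span_of_finite ℂ ((hA.finite x).image _)
  rw [← Module.finrank_eq_rank, Nat.cast_le, e.finrank_span_image (hA.finite x)]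

theorem isSimpleEig_iff (hA : IsEigenbasis A e lam) (μ : ℝ) : IsSimpleEig A μ ↔ {i | lam i = μ}.ncard = 1 := by
  rw [IsSimpleEig, hA.eigSpace_eq_span μ, e.finrank_span_image (hA.finite_eq μ)]

/-- Parseval for `(A - z) u`. The two estimates that follow compare it termwise with Parseval for
`u`, over the indices that actually occur in `u`. -/
theorem hasSum_sub_smul (hA : IsEigenbasis A e lam) (z : ℝ) (u : A.domain) :
    HasSum (fun i => (lam i - z) ^ 2 * ‖⟪e i, (u : H)⟫_ℂ‖ ^ 2) (‖A u - (z : ℂ) • (u : H)‖ ^ 2) := by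
  convert e.hasSum_norm_inner_sq (A u - (z : ℂ) • (u : H)) using 1
  ext i
  rw [inner_sub_right, hA.inner_apply, inner_smul_right, ← sub_mul, norm_mul, mul_pow,
    ← Complex.ofReal_sub, Complex.norm_real, Real.norm_eq_abs, sq_abs]

theorem mul_norm_le (hA : IsEigenbasis A e lam) {z ρ : ℝ} (hρ : 0 ≤ ρ) (u : A.domain)
    (h : ∀ i, ⟪e i, (u : H)⟫_ℂ ≠ 0 → ρ ≤ |lam i - z|) :
    ρ * ‖(u : H)‖ ≤ ‖A u - (z : ℂ) • (u : H)‖ := by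
  refine le_of_sq_le_sq ?_ (norm_nonneg _)
  rw [mul_pow]
  refine hasSum_le (fun i => ?_) ((e.hasSum_norm_inner_sq (u : H)).mul_left (ρ ^ 2))
    (hA.hasSum_sub_smul z u)
  by_cases hi : ⟪e i, (u : H)⟫_ℂ = 0
  · simp [hi]
  · refine mul_le_mul_of_nonneg_right ?_ (sq_nonneg _)
    rw [← sq_abs (lam i - z)]
    exact pow_le_pow_left₀ hρ (h i hi) 2

theorem norm_le_mul (hA : IsEigenbasis A e lam) {z r : ℝ} (hr : 0 ≤ r) (u : A.domain)
    (h : ∀ i, ⟪e i, (u : H)⟫_ℂ ≠ 0 → |lam i - z| ≤ r) :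
    ‖A u - (z : ℂ) • (u : H)‖ ≤ r * ‖(u : H)‖ := by
  refine le_of_sq_le_sq ?_ (by positivity)
  rw [mul_pow]
  refine hasSum_le (fun i => ?_) (hA.hasSum_sub_smul z u)
    ((e.hasSum_norm_inner_sq (u : H)).mul_left (r ^ 2))
  by_cases hi : ⟪e i, (u : H)⟫_ℂ = 0
  · simp [hi]
  · refine mul_le_mul_of_nonneg_right ?_ (sq_nonneg _)
    rw [← sq_abs (lam i - z)]
    exact pow_le_pow_left₀ (abs_nonneg _) (h i hi) 2

theorem mem_domain_of_mem_span (hA : IsEigenbasis A e lam) {s : Set ι} {v : H} (hv : v ∈ Submodule.span ℂ (e '' s)) :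
    v ∈ A.domain := by
  refine (Submodule.span_le.2 ?_ : Submodule.span ℂ (e '' s) ≤ A.domain) hv
  rintro _ ⟨i, -, rfl⟩
  exact (mem_eigSpace_iff.1 (hA.mem i)).1

end IsEigenbasis

end Eigenbasis

/-! ### Stability of simple eigenvalues under relatively small perturbations -/

section Perturbation

variable {H : Type*} [NormedAddCommGroup H] [InnerProductSpace ℂ H]

/-- The unitary `W` carries the domain of `A` onto the domain of `B`, and the transported operator
differs from `A` by a perturbation with relative bound `δ`. -/
structure IsGraphClose (W : H ≃ₗᵢ[ℂ] H) (A B : H →ₗ.[ℂ] H) (δ : ℝ) : Prop where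
  mem_iff : ∀ u, W u ∈ B.domain ↔ u ∈ A.domain
  norm_le : ∀ (u : H) (h : u ∈ A.domain) (h' : W u ∈ B.domain),
    ‖B ⟨W u, h'⟩ - W (A ⟨u, h⟩)‖ ≤ δ * (‖A ⟨u, h⟩‖ + ‖u‖)

/-- Let `D` be the norm of the difference. Then `‖A u‖ ≤ ‖B W u‖ + D`, so for `δ ≤ 1/2` the term `δ
D` can be absorbed at the price of doubling `δ`. Thus eigenvalues can be compared in both
directions. -/
theorem IsGraphClose.symm {W : H ≃ₗᵢ[ℂ] H} {A B : H →ₗ.[ℂ] H} {δ : ℝ} (h : IsGraphClose W A B δ)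
    (hδ : δ ≤ 1 / 2) (hδ0 : 0 ≤ δ) : IsGraphClose W.symm B A (2 * δ) where
  mem_iff u := by rw [← h.mem_iff, W.apply_symm_apply]
  norm_le u hu hu' := by
    obtain ⟨v, rfl⟩ := W.surjective u
    have hv : v ∈ A.domain := (h.mem_iff v).1 hu
    have e1 : (⟨W.symm (W v), hu'⟩ : A.domain) = ⟨v, hv⟩ := Subtype.ext (W.symm_apply_apply v)
    have e2 : ‖A ⟨v, hv⟩ - W.symm (B ⟨W v, hu⟩)‖ = ‖B ⟨W v, hu⟩ - W (A ⟨v, hv⟩)‖ := by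
      rw [← W.norm_map, map_sub, W.apply_symm_apply, norm_sub_rev]
    have h1 := h.norm_le v hv hu
    have h2 : ‖A ⟨v, hv⟩‖ ≤ ‖B ⟨W v, hu⟩‖ + ‖B ⟨W v, hu⟩ - W (A ⟨v, hv⟩)‖ := by
      rw [← W.norm_map (A ⟨v, hv⟩)]
      have := norm_sub_le (B ⟨W v, hu⟩) (B ⟨W v, hu⟩ - W (A ⟨v, hv⟩))
      rwa [sub_sub_cancel] at this
    rw [e1, e2, W.norm_map]
    nlinarith [norm_nonneg v, norm_nonneg (B ⟨W v, hu⟩),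
      norm_nonneg (B ⟨W v, hu⟩ - W (A ⟨v, hv⟩))]

variable {A B : H →ₗ.[ℂ] H} {W : H ≃ₗᵢ[ℂ] H} {δ : ℝ} {ι ι' : Type} {e : HilbertBasis ι ℂ H}
  {e' : HilbertBasis ι' ℂ H} {lam : ι → ℝ} {lam' : ι' → ℝ}

theorem IsGraphClose.norm_sub_smul_le (h : IsGraphClose W A B δ) (u : H) (hu : u ∈ A.domain)
    (hu' : W u ∈ B.domain) (z : ℂ) :
    ‖B ⟨W u, hu'⟩ - z • W u‖ ≤ ‖A ⟨u, hu⟩ - z • u‖ + δ * (‖A ⟨u, hu⟩‖ + ‖u‖) := by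
  have h1 : B ⟨W u, hu'⟩ - z • W u = W (A ⟨u, hu⟩ - z • u) + (B ⟨W u, hu'⟩ - W (A ⟨u, hu⟩)) := by
    rw [map_sub, map_smul]; abel
  rw [h1]
  refine (norm_add_le _ _).trans ?_
  rw [W.norm_map]
  exact add_le_add le_rfl (h.norm_le u hu hu')

/-- If the right count were smaller, some nonzero `v` spanned by the `e i` with `lam i ≤ x` would
have `W v` orthogonal to every `e' j` with `lam' j ≤ x + η`. For `z` the centre of `[-K, x]`, the
vector `(A - z) v` has norm at most `(x + K)/2 · ‖v‖` and `(B - z) W v` has norm at least `((x +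
K)/2 + η) ‖v‖`. Closeness allows these to differ by less than `η ‖v‖`. Norms replace quadratic forms
because the perturbation is controlled in the graph norm. -/
theorem ncard_sublevel_le (hA : IsEigenbasis A e lam) (hB : IsEigenbasis B e' lam')
    (h : IsGraphClose W A B δ) (hδ : 0 ≤ δ) {K x η : ℝ} (hK : ∀ i, -K ≤ lam i) (hK0 : 0 ≤ K)
    (hη : δ * (|x| + K + 1) < η) :
    {i | lam i ≤ x}.ncard ≤ {i | lam' i ≤ x + η}.ncard := by
  by_cases hx : x < -K
  · have : {i | lam i ≤ x} = ∅ := Set.eq_empty_of_forall_notMem fun i hi => by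
      have hi' : lam i ≤ x := hi
      linarith [hK i]
    rw [this, Set.ncard_empty]
    exact Nat.zero_le _
  rw [not_lt] at hx
  by_contra! hlt
  set S := {i | lam i ≤ x} with hS
  set S' := {i | lam' i ≤ x + η} with hS'
  have hSf : S.Finite := hA.finite x
  have := (hB.finite (x + η)).fintype
  have : FiniteDimensional ℂ (Submodule.span ℂ (e '' S)) :=
    FiniteDimensional.span_of_finite ℂ (hSf.image _)
  -- The low `B`-coefficients of `W v`: a map into a space of smaller dimension, hence with a
  -- kernel.
  let F : Submodule.span ℂ (e '' S) →ₗ[ℂ] (S' → ℂ) :=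
    LinearMap.pi fun j => (innerSL ℂ (e' j)).toLinearMap ∘ₗ W.toLinearEquiv.toLinearMap ∘ₗ
      Submodule.subtype _
  have hker : LinearMap.ker F ≠ ⊥ := by
    refine F.ker_ne_bot_of_finrank_lt ?_
    rw [e.finrank_span_image hSf, Module.finrank_fintype_fun_eq_card]
    rwa [Set.ncard_eq_toFinset_card', Set.toFinset_card] at hlt
  obtain ⟨⟨v, hv⟩, hFv, hv0⟩ := Submodule.exists_mem_ne_zero_of_ne_bot hker
  have hv0' : 0 < ‖v‖ := norm_pos_iff.2 fun h0 => hv0 (Subtype.ext h0)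
  have hFv' : ∀ j, lam' j ≤ x + η → ⟪e' j, W v⟫_ℂ = 0 := fun j hj =>
    congrFun (LinearMap.mem_ker.1 hFv) (⟨j, hj⟩ : S')
  have hvA : v ∈ A.domain := hA.mem_domain_of_mem_span hv
  have hvB : W v ∈ B.domain := (h.mem_iff v).2 hvA
  have hcoef : ∀ i, ⟪e i, v⟫_ℂ ≠ 0 → lam i ≤ x := fun i hi => by
    by_contra hcon
    exact hi (e.inner_eq_zero_of_mem_span hv hcon)
  have hup : ‖A ⟨v, hvA⟩ - (((x - K) / 2 : ℝ) : ℂ) • v‖ ≤ (x + K) / 2 * ‖v‖ :=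
    hA.norm_le_mul (by linarith) ⟨v, hvA⟩ fun i hi => by
      rw [abs_le]
      constructor <;> linarith [hcoef i hi, hK i]
  have hup0 : ‖A ⟨v, hvA⟩‖ ≤ (|x| + K) * ‖v‖ := by
    have h1 := hA.norm_le_mul (z := 0) (r := |x| + K) (by positivity) ⟨v, hvA⟩ fun i hi => by
      rw [sub_zero, abs_le]
      constructor <;> linarith [hcoef i hi, hK i, le_abs_self x, abs_nonneg x]
    simpa using h1
  have hη0 : 0 < η := lt_of_le_of_lt (by positivity) hη
  have hlow : ((x + K) / 2 + η) * ‖W v‖ ≤ ‖B ⟨W v, hvB⟩ - (((x - K) / 2 : ℝ) : ℂ) • W v‖ :=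
    hB.mul_norm_le (by linarith) ⟨W v, hvB⟩ fun j hj => by
      have h1 : x + η < lam' j := not_le.1 fun hcon => hj (hFv' j hcon)
      exact le_trans (by linarith) (le_abs_self _)
  have hmid := h.norm_sub_smul_le v hvA hvB (((x - K) / 2 : ℝ) : ℂ)
  rw [W.norm_map] at hlow
  have h1 : δ * (‖A ⟨v, hvA⟩‖ + ‖v‖) ≤ δ * (|x| + K + 1) * ‖v‖ := by
    rw [mul_assoc]
    refine mul_le_mul_of_nonneg_left ?_ hδ
    linarith
  have h2 : δ * (|x| + K + 1) * ‖v‖ < η * ‖v‖ := mul_lt_mul_of_pos_right hη hv0'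
  linarith

/-- Supplies one lower bound for the eigenvalues of all perturbed operators, as needed when
`ncard_sublevel_le` is used from `B` to `A`. An eigenvalue `μ` of `B` with unit eigenvector `W u`
gives `-C - μ ≤ ‖(A - μ) u‖ ≤ δ (‖(A - μ) u‖ + |μ| + 1)`, which for `δ ≤ 1/4` fails when `μ < -(2C +
1)`. -/
theorem eigenvalue_ge_of_isGraphClose (hA : IsEigenbasis A e lam) (hB : IsEigenbasis B e' lam')
    (h : IsGraphClose W A B δ) (hδ : 0 ≤ δ) (hδ' : δ ≤ 1 / 4) {C : ℝ} (hC : ∀ i, -C ≤ lam i)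
    (hC0 : 0 ≤ C) (j : ι') : -(2 * C + 1) ≤ lam' j := by
  by_contra! hlt
  obtain ⟨u, hu⟩ := W.surjective (e' j)
  have hu1 : ‖u‖ = 1 := by rw [← W.norm_map, hu, e'.orthonormal.1]
  obtain ⟨huB, hBu⟩ := mem_eigSpace_iff.1 (hu ▸ hB.mem j : W u ∈ eigSpace B (lam' j))
  have huA : u ∈ A.domain := (h.mem_iff u).1 huB
  have h1 := h.norm_le u huA huB
  have h2 : ‖B ⟨W u, huB⟩ - W (A ⟨u, huA⟩)‖ = ‖A ⟨u, huA⟩ - (lam' j : ℂ) • u‖ := by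
    rw [hBu, ← map_smul, ← map_sub, W.norm_map, norm_sub_rev]
  have h3 : ‖A ⟨u, huA⟩‖ ≤ ‖A ⟨u, huA⟩ - (lam' j : ℂ) • u‖ + |lam' j| := by
    have := norm_add_le (A ⟨u, huA⟩ - (lam' j : ℂ) • u) ((lam' j : ℂ) • u)
    rwa [sub_add_cancel, norm_smul, hu1, mul_one, Complex.norm_real, Real.norm_eq_abs] at this
  have h4 := hA.mul_norm_le (z := lam' j) (ρ := -C - lam' j) (by linarith) ⟨u, huA⟩ fun i _ =>
    le_trans (by linarith [hC i]) (le_abs_self _)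
  rw [h2, hu1] at h1
  simp only [hu1, mul_one] at h4
  rw [abs_of_neg (by linarith)] at h3
  nlinarith [norm_nonneg (A ⟨u, huA⟩)]

theorem HilbertBasis.infinite_of_not_finiteDimensional (e : HilbertBasis ι ℂ H)
    (h : ¬ FiniteDimensional ℂ H) : Infinite ι := by
  by_contra hfin
  rw [not_infinite_iff_finite] at hfin
  refine h ?_
  have h1 : Submodule.span ℂ (e '' Set.univ) = ⊤ := (Submodule.eq_top_iff').2 fun v =>
    e.mem_span_of_inner_eq_zero Set.finite_univ fun i hi => absurd (Set.mem_univ i) hi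
  have h2 : FiniteDimensional ℂ (Submodule.span ℂ (e '' Set.univ)) :=
    FiniteDimensional.span_of_finite ℂ (Set.finite_univ.image _)
  rw [h1] at h2
  exact Module.Finite.equiv Submodule.topEquiv

/-- Removing from `W⁻¹ φ` its component along `ψ` leaves only eigenvalues at distance at least `g`
from `l`, and does not change its image under `A - l`. That image is small because `φ` is an
eigenvector of `B` for `l'`. -/
theorem IsGraphClose.exists_smul_eigenvector (hA : IsEigenbasis A e lam)
    (h : IsGraphClose W.symm B A δ) {l g : ℝ} (hg : 0 ≤ g)
    (hsimple : {i | lam i = l}.ncard = 1) (hgap : ∀ i, lam i ≠ l → g ≤ |lam i - l|)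
    {ψ φ : H} (hψ : IsNormalizedEig A l ψ) {l' : ℝ} (hφ : IsNormalizedEig B l' φ) :
    ∃ κ : ℂ, g * ‖W.symm φ - κ • ψ‖ ≤ |l' - l| + δ * (|l'| + 1) := by
  obtain ⟨i, hi⟩ := Set.ncard_eq_one.1 hsimple
  have hψ1 := hψ.1
  rw [hA.eigSpace_eq_span, hi, Set.image_singleton, Submodule.mem_span_singleton] at hψ1
  obtain ⟨c, rfl⟩ := hψ1
  have hc : c ≠ 0 := by
    rintro rfl
    simpa using hψ.2
  have hli : lam i = l := hi.ge (Set.mem_singleton i)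
  obtain ⟨hφB, hφ'⟩ := mem_eigSpace_iff.1 hφ.1
  have huA : W.symm φ ∈ A.domain := (h.mem_iff φ).2 hφB
  obtain ⟨hiA, hi'⟩ := mem_eigSpace_iff.1 (hA.mem i)
  set u := W.symm φ with hu
  have hu1 : ‖u‖ = 1 := by rw [hu, W.symm.norm_map, hφ.2]
  -- As `ψ = c • e i`, this choice makes `κ • ψ` the orthogonal projection of `u` onto the
  -- eigenline.
  refine ⟨⟪e i, u⟫_ℂ * c⁻¹, ?_⟩
  rw [smul_smul, inv_mul_cancel_right₀ hc]
  set w : A.domain := ⟨u, huA⟩ - ⟪e i, u⟫_ℂ • ⟨e i, hiA⟩ with hw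
  have hw' : (w : H) = u - ⟪e i, u⟫_ℂ • e i := rfl
  have h1 := hA.mul_norm_le (z := l) hg w fun j hj => hgap j fun hjl => hj (by
    have hji : j = i := hi.le (show j ∈ {i | lam i = l} from hjl)
    rw [hw', hji, inner_sub_right, inner_smul_right, inner_self_eq_norm_sq_to_K,
      e.orthonormal.1]
    simp)
  have h2 : A w - (l : ℂ) • (w : H) = A ⟨u, huA⟩ - (l : ℂ) • u := by
    rw [hw', hw, LinearPMap.map_sub, LinearPMap.map_smul, hi', hli, smul_sub,
      smul_comm (l : ℂ)]
    abel
  rw [h2, hw'] at h1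
  have h3 := h.norm_sub_smul_le φ hφB huA l
  rw [hφ', ← sub_smul, norm_smul, norm_smul, hφ.2, mul_one, mul_one, ← Complex.ofReal_sub,
    Complex.norm_real, Complex.norm_real, Real.norm_eq_abs, Real.norm_eq_abs] at h3
  exact h1.trans h3

/-- Under small perturbations a simple eigenvalue of a self-adjoint operator with compact resolvent
stays simple and the eigenvector moves little, up to a scalar factor. -/
theorem IsSBC.simple_stable [CompleteSpace H] (hA : IsSBC A) (hinf : ¬ FiniteDimensional ℂ H)
    {n : ℕ} (hn : 1 ≤ n) (hs : IsSimpleEig A (nthEig A n)) {η : ℝ} (hη : 0 < η) :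
    ∃ δ : ℝ, 0 < δ ∧ ∀ (W : H ≃ₗᵢ[ℂ] H) (B : H →ₗ.[ℂ] H), IsSBC B → IsGraphClose W A B δ →
      IsSimpleEig B (nthEig B n) ∧ ∀ ψ φ : H, IsNormalizedEig A (nthEig A n) ψ →
        IsNormalizedEig B (nthEig B n) φ → ∃ κ : ℂ, ‖W.symm φ - κ • ψ‖ ≤ η := by
  obtain ⟨ι, e, lam, hlam⟩ := hA.exists_eigenbasis
  have hι := e.infinite_of_not_finiteDimensional hinf
  obtain ⟨c, hc⟩ := hA.2.1
  obtain ⟨C, hC0, hC⟩ : ∃ C : ℝ, 0 ≤ C ∧ ∀ i, -C ≤ lam i := by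
    refine ⟨|c|, abs_nonneg c, fun i => ?_⟩
    obtain ⟨h, h'⟩ := mem_eigSpace_iff.1 (hlam.mem i)
    have h1 := norm_sub_smul_ge_of_lower hc (lam i) ⟨e i, h⟩
    rw [h', sub_self, norm_zero] at h1
    simp only [e.orthonormal.1, mul_one] at h1
    linarith [neg_abs_le c]
  have hne : nthEig A n = nthSmallest lam n := hlam.nthEig_eq n
  generalize nthEig A n = l at hs hne ⊢
  rw [hlam.isSimpleEig_iff] at hs
  obtain ⟨g, hg, hgap⟩ := exists_gap hlam.finite l
  -- `3 ε ≤ g` is the gap required for interlacing; `ε ≤ g η / 2` is half of the allowed eigenvector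
  -- error, for the shift of the eigenvalue.
  obtain ⟨ε, hε0, hε1, hε2⟩ : ∃ ε : ℝ, 0 < ε ∧ 3 * ε ≤ g ∧ ε ≤ g * η / 2 :=
    ⟨min (g / 3) (g * η / 2), lt_min (by positivity) (by positivity), by
      linarith [min_le_left (g / 3) (g * η / 2)], min_le_right _ _⟩
  -- `M` bounds `|x| + K + 1` for `K = 2C + 1` and every level `x` within `2ε` of `l`.
  obtain ⟨M, hM⟩ : ∃ M : ℝ, M = |l| + 2 * ε + (2 * C + 1) + 1 := ⟨_, rfl⟩
  have hM0 : 0 < M := by rw [hM]; positivity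
  -- The constant `2δ` belongs to the inverse comparison. The bound `ε / 2` serves the half shift in
  -- the last counting inequality, and `g η / 2` the other half of the eigenvector error.
  obtain ⟨δ, hδ0, hδ1, hδ2, hδ3⟩ : ∃ δ : ℝ, 0 < δ ∧ δ ≤ 1 / 4 ∧ 2 * δ * M < ε / 2 ∧
      2 * δ * M ≤ g * η / 2 := by
    refine ⟨min (1 / 4) (min (ε / (8 * M)) (g * η / (4 * M))), by positivity,
      min_le_left _ _, ?_, ?_⟩
    · have h1 : min (1 / 4) (min (ε / (8 * M)) (g * η / (4 * M))) ≤ ε / (8 * M) :=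
        (min_le_right _ _).trans (min_le_left _ _)
      rw [le_div_iff₀ (by positivity)] at h1
      linarith
    · have h1 : min (1 / 4) (min (ε / (8 * M)) (g * η / (4 * M))) ≤ g * η / (4 * M) :=
        (min_le_right _ _).trans (min_le_right _ _)
      rw [le_div_iff₀ (by positivity)] at h1
      linarith
  refine ⟨δ, hδ0, fun W B hB hW => ?_⟩
  obtain ⟨ι', e', lam', hlam'⟩ := hB.exists_eigenbasis
  have hι' := e'.infinite_of_not_finiteDimensional hinf
  have hW' := hW.symm (by linarith) hδ0.le
  have hK : ∀ i, -(2 * C + 1) ≤ lam i := fun i => by linarith [hC i]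
  have hK' := eigenvalue_ge_of_isGraphClose hlam hlam' hW hδ0.le hδ1 hC hC0
  have hsmall : ∀ x, |x - l| ≤ 2 * ε → 2 * δ * (|x| + (2 * C + 1) + 1) < ε / 2 := by
    intro x hx
    refine lt_of_le_of_lt (mul_le_mul_of_nonneg_left ?_ (by positivity)) hδ2
    have := abs_sub_abs_le_abs_sub x l
    linarith
  have hsmall' : ∀ x, |x - l| ≤ 2 * ε → δ * (|x| + (2 * C + 1) + 1) < ε := by
    intro x hx
    have h1 := hsmall x hx
    have h2 : 0 ≤ δ * (|x| + (2 * C + 1) + 1) := by positivity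
    linarith
  have a1 : |l + ε - l| ≤ 2 * ε := by rw [abs_le]; constructor <;> linarith
  have a2 : |l - ε - l| ≤ 2 * ε := by rw [abs_le]; constructor <;> linarith
  have a3 : |l - ε - ε - l| ≤ 2 * ε := by rw [abs_le]; constructor <;> linarith
  have a0 : |l - l| ≤ 2 * ε := by rw [abs_le]; constructor <;> linarith
  have hK0 : 0 ≤ 2 * C + 1 := by linarith
  obtain ⟨r1, r2⟩ := ncard_eq_one_of_interlacing hlam.finite hlam'.finite hK hK' hn hne hε0 hs
    (fun i hi => hε1.trans (hgap i hi))
    (ncard_sublevel_le hlam hlam' hW hδ0.le hK hK0 (hsmall' _ a0))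
    (ncard_sublevel_le hlam' hlam hW' (by positivity) hK' hK0
      ((hsmall _ a1).trans (by linarith)))
    (ncard_sublevel_le hlam hlam' hW hδ0.le hK hK0 (hsmall' _ a3))
    (ncard_sublevel_le hlam' hlam hW' (by positivity) hK' hK0 (hsmall _ a2))
  rw [hlam'.nthEig_eq n]
  refine ⟨(hlam'.isSimpleEig_iff _).2 r1, fun ψ φ hψ hφ => ?_⟩
  obtain ⟨κ, hκ⟩ := IsGraphClose.exists_smul_eigenvector hlam hW' hg.le hs hgap hψ hφ
  refine ⟨κ, le_of_mul_le_mul_left (hκ.trans ?_) hg⟩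
  have h1 : |nthSmallest lam' n| + 1 ≤ M := by
    have := abs_sub_abs_le_abs_sub (nthSmallest lam' n) l
    linarith
  have h2 : 2 * δ * (|nthSmallest lam' n| + 1) ≤ 2 * δ * M :=
    mul_le_mul_of_nonneg_left h1 (by positivity)
  linarith

end Perturbation

/-! ### Plane waves and modulations -/

section Modulation

variable {d m : ℕ}

/-- The plane wave `e^{i⟨τ, x⟩}`. -/
noncomputable def planeWave (τ x : Rd d) : ℂ := Complex.exp (Complex.I * (⟪τ, x⟫_ℝ : ℝ))

theorem norm_planeWave (τ x : Rd d) : ‖planeWave τ x‖ = 1 := by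
  rw [planeWave, mul_comm]
  exact Complex.norm_exp_ofReal_mul_I _

theorem planeWave_add_left (τ σ x : Rd d) :
    planeWave (τ + σ) x = planeWave τ x * planeWave σ x := by
  rw [planeWave, planeWave, planeWave, ← Complex.exp_add, inner_add_left]
  push_cast
  ring_nf

theorem planeWave_add_right (τ x y : Rd d) :
    planeWave τ (x + y) = planeWave τ x * planeWave τ y := by
  rw [planeWave, planeWave, planeWave, ← Complex.exp_add, inner_add_right]
  push_cast
  ring_nf

theorem planeWave_zero (x : Rd d) : planeWave 0 x = 1 := by simp [planeWave]

theorem planeWave_neg_mul (τ x : Rd d) : planeWave (-τ) x * planeWave τ x = 1 := by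
  rw [← planeWave_add_left, neg_add_cancel, planeWave_zero]

theorem contDiff_planeWave (τ : Rd d) : ContDiff ℝ ∞ (planeWave τ) := by
  unfold planeWave
  have h : ContDiff ℝ ∞ (fun x : Rd d => ((⟪τ, x⟫_ℝ : ℝ) : ℂ)) :=
    Complex.ofRealCLM.contDiff.comp (innerSL ℝ τ).contDiff
  exact (contDiff_const.mul h).cexp

theorem norm_planeWave_sub_one_le (τ x : Rd d) : ‖planeWave τ x - 1‖ ≤ ‖τ‖ * ‖x‖ :=
  (Real.norm_exp_I_mul_ofReal_sub_one_le).trans (abs_real_inner_le_norm τ x)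

theorem memLp_planeWave_smul {μ : Measure (Rd d)} (τ : Rd d) {f : Rd d → Cm m}
    (hf : MemLp f 2 μ) : MemLp (fun x => planeWave τ x • f x) 2 μ :=
  hf.of_le ((contDiff_planeWave τ).continuous.aestronglyMeasurable.smul hf.1)
    (Filter.Eventually.of_forall fun x => by rw [norm_smul, norm_planeWave, one_mul])

variable (b : Module.Basis (Fin d) ℝ (Rd d))

/-- Multiplication by the plane wave `e^{i⟨τ, x⟩}` in `L_2^m(F)`, as a linear map. -/
noncomputable def modulationₗ (m : ℕ) (τ : Rd d) : L2cell b m →ₗ[ℂ] L2cell b m where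
  toFun u := (memLp_planeWave_smul τ (Lp.memLp u)).toLp _
  map_add' u v := by
    rw [← MemLp.toLp_add, MemLp.toLp_eq_toLp_iff]
    filter_upwards [Lp.coeFn_add u v] with x hx
    rw [hx, Pi.add_apply, Pi.add_apply, smul_add]
  map_smul' c u := by
    rw [RingHom.id_apply, ← MemLp.toLp_const_smul, MemLp.toLp_eq_toLp_iff]
    filter_upwards [Lp.coeFn_smul c u] with x hx
    rw [hx, Pi.smul_apply, Pi.smul_apply, smul_comm]

theorem coeFn_modulationₗ (τ : Rd d) (u : L2cell b m) :
    modulationₗ b m τ u =ᵐ[volume.restrict (cell b)] fun x => planeWave τ x • u x :=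
  MemLp.coeFn_toLp (memLp_planeWave_smul τ (Lp.memLp u))

theorem modulationₗ_neg_apply (τ : Rd d) (u : L2cell b m) :
    modulationₗ b m (-τ) (modulationₗ b m τ u) = u := by
  refine Lp.ext ?_
  filter_upwards [coeFn_modulationₗ b (-τ) (modulationₗ b m τ u), coeFn_modulationₗ b τ u]
    with x h1 h2
  rw [h1, h2, smul_smul, planeWave_neg_mul, one_smul]

theorem norm_modulationₗ (τ : Rd d) (u : L2cell b m) : ‖modulationₗ b m τ u‖ = ‖u‖ := by
  rw [Lp.norm_def, Lp.norm_def]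
  congr 1
  refine eLpNorm_congr_norm_ae ?_
  filter_upwards [coeFn_modulationₗ b τ u] with x hx
  rw [hx, norm_smul, norm_planeWave, one_mul]

/-- Multiplication by the plane wave `e^{i⟨τ, x⟩}`, as a unitary operator in `L_2^m(F)`. -/
noncomputable def modulation (m : ℕ) (τ : Rd d) : L2cell b m ≃ₗᵢ[ℂ] L2cell b m where
  toLinearEquiv := LinearEquiv.ofLinearMap (modulationₗ b m τ) (modulationₗ b m (-τ))
    (LinearMap.ext fun u => by
      have := modulationₗ_neg_apply b (m := m) (-τ) u
      rwa [neg_neg] at this)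
    (LinearMap.ext fun u => modulationₗ_neg_apply b τ u)
  norm_map' u := norm_modulationₗ b τ u

theorem coeFn_modulation (τ : Rd d) (u : L2cell b m) :
    modulation b m τ u =ᵐ[volume.restrict (cell b)] fun x => planeWave τ x • u x :=
  coeFn_modulationₗ b τ u

theorem modulation_neg_apply (τ : Rd d) (u : L2cell b m) :
    modulation b m (-τ) (modulation b m τ u) = u :=
  modulationₗ_neg_apply b τ u

/-- Since `F` is bounded, modulations tend to the identity in operator norm; this controls their
commutator with `B_t`. -/
theorem norm_modulation_sub_le (τ : Rd d) (u : L2cell b m) :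
    ‖modulation b m τ u - u‖ ≤ ‖τ‖ * (∑ i, ‖b i‖) * ‖u‖ := by
  refine Lp.norm_le_mul_norm_of_ae_le_mul ?_
  filter_upwards [Lp.coeFn_sub (modulation b m τ u) u, coeFn_modulation b τ u,
    ae_restrict_mem (ZSpan.fundamentalDomain_measurableSet b)] with x h1 h2 hx
  have h3 : planeWave τ x • u x - u x = (planeWave τ x - 1) • u x := by rw [sub_smul, one_smul]
  rw [h1, Pi.sub_apply, h2, h3, norm_smul]
  refine mul_le_mul_of_nonneg_right ((norm_planeWave_sub_one_le τ x).trans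
    (mul_le_mul_of_nonneg_left ?_ (norm_nonneg _))) (norm_nonneg _)
  have h4 := ZSpan.norm_fract_le b x
  rwa [ZSpan.fract_eq_self.2 hx] at h4

theorem matMul_modulation {M : Rd d → Matrix (Fin m) (Fin m) ℂ} (hM : IsBddMatrix M) (τ : Rd d)
    (u : L2cell b m) :
    matMul b M hM (modulation b m τ u) = modulation b m τ (matMul b M hM u) := by
  have hc : ∀ v, matMul b M hM v =ᵐ[volume.restrict (cell b)]
      fun x => (WithLp.toLp 2 (M x *ᵥ (v x).ofLp) : Cm m) := fun v => MemLp.coeFn_toLp (memLp_matVec b hM v)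
  refine Lp.ext ?_
  filter_upwards [hc (modulation b m τ u), hc u, coeFn_modulation b τ u,
    coeFn_modulation b τ (matMul b M hM u)] with x h1 h2 h3 h4
  rw [h1, h3, h4, h2, WithLp.ofLp_smul, Matrix.mulVec_smul, WithLp.toLp_smul]

theorem exists_norm_matMul_le {M : Rd d → Matrix (Fin m) (Fin m) ℂ} (hM : IsBddMatrix M) :
    ∃ C : ℝ, 0 ≤ C ∧ ∀ u : L2cell b m, ‖matMul b M hM u‖ ≤ C * ‖u‖ := by
  obtain ⟨C, hC⟩ := hM.2
  refine ⟨m * (m * |C|), by positivity, fun u => Lp.norm_le_mul_norm_of_ae_le_mul ?_⟩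
  have hc : matMul b M hM u =ᵐ[volume.restrict (cell b)]
      fun x => (WithLp.toLp 2 (M x *ᵥ (u x).ofLp) : Cm m) := MemLp.coeFn_toLp (memLp_matVec b hM u)
  filter_upwards [hc] with x hx
  rw [hx]
  have h1 : ∀ i, ‖(M x *ᵥ (u x).ofLp) i‖ ≤ m * |C| * ‖u x‖ := by
    intro i
    rw [Matrix.mulVec, dotProduct]
    refine (norm_sum_le _ _).trans ((Finset.sum_le_card_nsmul _ _ (|C| * ‖u x‖) fun j _ => ?_).trans
      (by simp [mul_assoc]))
    rw [norm_mul]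
    exact mul_le_mul ((hC x i j).trans (le_abs_self C)) (PiLp.norm_apply_le _ j) (norm_nonneg _)
      (abs_nonneg _)
  have h2 : (WithLp.toLp 2 (M x *ᵥ (u x).ofLp) : Cm m) =
      ∑ i, EuclideanSpace.single i ((M x *ᵥ (u x).ofLp) i) := by
    ext k
    simp
  rw [h2]
  refine (norm_sum_le _ _).trans ((Finset.sum_le_card_nsmul _ _ (m * |C| * ‖u x‖)
    fun i _ => ?_).trans (by simp [mul_assoc]))
  rw [PiLp.norm_single]
  exact h1 i

/-- Write `x` as lattice part plus cell part: the new quasimomentum contributes `e^{i⟨τ,·⟩}` at the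
first, the multiplication in the cell at the second. -/
theorem quasiExt_modulation (t τ : Rd d) (u : L2cell b m) :
    quasiExt b (t + τ) (modulation b m τ u) =ᵐ[volume]
      fun x => planeWave τ x • quasiExt b t u x := by
  filter_upwards [comp_fract_congr b (coeFn_modulation b τ u)] with x hx
  rw [quasiExt, hx, quasiExt]
  change planeWave (t + τ) _ • _ = planeWave τ x • planeWave t _ • _
  rw [planeWave_add_left, smul_smul, smul_smul]
  congr 1
  have h1 : planeWave τ x = planeWave τ (ZSpan.floor b x : Rd d) * planeWave τ (ZSpan.fract b x) := by
    rw [← planeWave_add_right, ZSpan.fract, add_sub_cancel]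
  rw [h1]
  ring

/-- Both factors of the inner product acquire the same unimodular factor. Thus coefficients at
different quasimomenta become pairings with one fixed plane wave. -/
theorem planeCoeff_modulation (t τ : Rd d) (v : Cm m) (Ψ : L2cell b m) :
    planeCoeff b (t + τ) v (modulation b m τ Ψ) = planeCoeff b t v Ψ := by
  refine integral_congr_ae ?_
  filter_upwards [coeFn_modulation b τ Ψ] with x hx
  rw [hx]
  change ⟪planeWave (t + τ) x • v, _⟫_ℂ = ⟪planeWave t x • v, _⟫_ℂ
  rw [inner_smul_left, inner_smul_left, inner_smul_right, planeWave_add_left, map_mul]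
  have h1 : (starRingEnd ℂ) (planeWave τ x) * planeWave τ x = 1 := by
    rw [Complex.conj_mul', norm_planeWave]
    simp
  linear_combination ((starRingEnd ℂ) (planeWave t x) * ⟪v, Ψ x⟫_ℂ) * h1

theorem isFiniteMeasure_restrict_cell : IsFiniteMeasure (volume.restrict (cell b)) :=
  ⟨by
    rw [Measure.restrict_apply_univ]
    exact (ZSpan.fundamentalDomain_isBounded b).measure_lt_top⟩

theorem exists_planeCoeff_eq_inner (t : Rd d) (v : Cm m) :
    ∃ K : L2cell b m, ∀ Ψ, planeCoeff b t v Ψ = ⟪K, Ψ⟫_ℂ := by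
  have := isFiniteMeasure_restrict_cell b
  have hK : MemLp (fun x => planeWave t x • v) 2 (volume.restrict (cell b)) :=
    memLp_planeWave_smul t (memLp_const v)
  refine ⟨hK.toLp _, fun Ψ => ?_⟩
  rw [L2.inner_def]
  refine integral_congr_ae ?_
  filter_upwards [hK.coeFn_toLp] with x hx
  rw [hx]
  rfl

theorem volume_coord_eq_zero (j : Fin d) (c : ℝ) : volume {x : Rd d | x j = c} = 0 := by
  have h1 : {x : Rd d | x j = c} =
      (MeasurableEquiv.toLp 2 (Fin d → ℝ)).symm ⁻¹' {f : Fin d → ℝ | f j = c} := rfl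
  rw [h1, (EuclideanSpace.volume_preserving_symm_measurableEquiv_toLp (Fin d)).measure_preimage_equiv]
  exact Measure.pi_hyperplane (fun _ : Fin d => (volume : Measure ℝ)) j c

/-- In a nonzero finite-dimensional space, multiplication by `arctan` of the first coordinate would
have an eigenvector. This would vanish off a hyperplane, hence almost everywhere. Using `arctan`
keeps the multiplier bounded and injective in that coordinate. Infinite dimension ensures that there
is an `n`-th eigenvalue for every `n`. -/
theorem not_finiteDimensional_L2cell (hd : 1 ≤ d) (hm : 1 ≤ m) :
    ¬ FiniteDimensional ℂ (L2cell b m) := by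
  intro hfin
  have := isFiniteMeasure_restrict_cell b
  have hnt : Nontrivial (L2cell b m) := by
    refine ⟨⟨(memLp_const (EuclideanSpace.single (⟨0, hm⟩ : Fin m) (1 : ℂ))).toLp _, 0, fun h => ?_⟩⟩
    have h1 := MemLp.coeFn_toLp (memLp_const (μ := volume.restrict (cell b)) (p := 2)
      (EuclideanSpace.single (⟨0, hm⟩ : Fin m) (1 : ℂ)))
    rw [h] at h1
    have h2 : ∀ᵐ x ∂(volume.restrict (cell b)), False := by
      filter_upwards [h1, Lp.coeFn_zero (Cm m) 2 (volume.restrict (cell b))] with x hx hx'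
      rw [hx'] at hx
      have := congrArg (fun w : Cm m => ‖w‖) hx
      simp at this
    rw [ae_iff] at h2
    simp only [not_false_eq_true, Set.ofPred_true, Measure.restrict_apply_univ] at h2
    exact ZSpan.measure_fundamentalDomain_ne_zero b h2
  let j : Fin d := ⟨0, hd⟩
  have hM : IsBddMatrix (fun x : Rd d => ((Real.arctan (x j) : ℝ) : ℂ) •
      (1 : Matrix (Fin m) (Fin m) ℂ)) := by
    constructor
    · intro i k
      have : Measurable fun x : Rd d => ((Real.arctan (x j) : ℝ) : ℂ) :=
        (Complex.continuous_ofReal.comp (Real.continuous_arctan.comp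
          (by fun_prop : Continuous fun x : Rd d => x j))).measurable
      exact this.mul_const _
    · refine ⟨Real.pi / 2, fun x i k => ?_⟩
      have h1 : |Real.arctan (x j)| ≤ Real.pi / 2 :=
        abs_le.2 ⟨(Real.neg_pi_div_two_lt_arctan _).le, (Real.arctan_lt_pi_div_two _).le⟩
      change ‖(((Real.arctan (x j) : ℝ) : ℂ) • (1 : Matrix (Fin m) (Fin m) ℂ)) i k‖ ≤ _
      rw [Matrix.smul_apply, Matrix.one_apply, smul_eq_mul, norm_mul, Complex.norm_real,
        Real.norm_eq_abs]
      split_ifs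
      · simpa using h1
      · rw [norm_zero, mul_zero]
        positivity
  obtain ⟨μ, hμ⟩ := Module.End.exists_eigenvalue (matMul b _ hM)
  obtain ⟨f, hf, hf0⟩ := hμ.exists_hasEigenvector
  rw [Module.End.mem_eigenspace_iff] at hf
  refine hf0 (Lp.ext ?_)
  have h1 := MemLp.coeFn_toLp (memLp_matVec b hM f)
  have h2 : (memLp_matVec b hM f).toLp _ = μ • f := hf
  rw [h2] at h1
  have h3 : ∀ᵐ x ∂(volume.restrict (cell b)), ¬ x j = Real.tan μ.re :=
    ae_restrict_of_ae (by
      rw [ae_iff]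
      simpa using volume_coord_eq_zero j (Real.tan μ.re))
  filter_upwards [h1, h3, Lp.coeFn_smul μ f, Lp.coeFn_zero (Cm m) 2 (volume.restrict (cell b))]
    with x hx1 hx3 hx2 hx0
  rw [hx0, Pi.zero_apply]
  rw [hx2, Pi.smul_apply, Matrix.smul_mulVec, Matrix.one_mulVec, WithLp.toLp_smul,
    ← sub_eq_zero, ← sub_smul] at hx1
  refine (smul_eq_zero.1 hx1).resolve_left fun h => hx3 ?_
  rw [sub_eq_zero.1 h, Complex.ofReal_re, Real.tan_arctan]

end Modulation

/-! ### The Leibniz rule for plane waves -/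

section Leibniz

variable {d m : ℕ}

theorem ContDiff.differentiable_test {φ : Rd d → ℂ} (h : ContDiff ℝ ∞ φ) : Differentiable ℝ φ :=
  h.differentiable (by simp)

theorem partialD_add (j : Fin d) {φ ψ : Rd d → ℂ} (hφ : ContDiff ℝ ∞ φ) (hψ : ContDiff ℝ ∞ ψ) :
    partialD j (φ + ψ) = partialD j φ + partialD j ψ := by
  funext x
  simp only [partialD, Pi.add_apply]
  rw [fderiv_add (hφ.differentiable_test x) (hψ.differentiable_test x)]
  simp [mul_add]

theorem partialD_smul (j : Fin d) (c : ℂ) {φ : Rd d → ℂ} (hφ : ContDiff ℝ ∞ φ) :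
    partialD j (c • φ) = c • partialD j φ := by
  funext x
  simp only [partialD, Pi.smul_apply]
  rw [fderiv_const_smul (hφ.differentiable_test x)]
  simp only [smul_apply, smul_eq_mul]
  ring

theorem partialD_sum (j : Fin d) {J : Type*} (s : Finset J) {φ : J → Rd d → ℂ}
    (hφ : ∀ i, ContDiff ℝ ∞ (φ i)) : partialD j (∑ i ∈ s, φ i) = ∑ i ∈ s, partialD j (φ i) := by
  classical
  induction s using Finset.induction_on with
  | empty =>
    funext x
    simp [partialD]
  | insert a s ha ih =>
    rw [Finset.sum_insert ha, Finset.sum_insert ha, partialD_add j (hφ a), ih]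
    have := ContDiff.sum (s := s) fun i (_ : i ∈ s) => hφ i
    convert this using 1
    ext x
    simp

theorem partialD_comm (j k : Fin d) {φ : Rd d → ℂ} (hφ : ContDiff ℝ ∞ φ) :
    partialD j (partialD k φ) = partialD k (partialD j φ) := by
  have h1 : Differentiable ℝ (fderiv ℝ φ) :=
    (hφ.fderiv_right (m := ∞) (by simp)).differentiable (by simp)
  have h2 : ∀ (v w x : Rd d), fderiv ℝ (fun y => (1 / Complex.I) * fderiv ℝ φ y v) x w =
      (1 / Complex.I) * fderiv ℝ (fderiv ℝ φ) x w v := by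
    intro v w x
    have h3 : HasFDerivAt (fun y => fderiv ℝ φ y v)
        ((ContinuousLinearMap.apply ℝ ℂ v) ∘L (fderiv ℝ (fderiv ℝ φ) x)) x :=
      (ContinuousLinearMap.apply ℝ ℂ v).hasFDerivAt.comp x (h1 x).hasFDerivAt
    rw [(h3.const_mul (1 / Complex.I)).fderiv]
    simp
  funext x
  unfold partialD
  rw [h2, h2]
  congr 2
  exact ((hφ.contDiffAt (x := x)).isSymmSndFDerivAt (by
    simpa using WithTop.coe_le_coe.2 (le_top : (2 : ℕ∞) ≤ ⊤))) _ _

theorem partialD_planeWave_mul (j : Fin d) (τ : Rd d) {φ : Rd d → ℂ} (hφ : ContDiff ℝ ∞ φ) :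
    partialD j (planeWave τ * φ) =
      planeWave τ * partialD j φ + ((τ j : ℝ) : ℂ) • (planeWave τ * φ) := by
  funext x
  have h1 : HasFDerivAt (fun x : Rd d => ((⟪τ, x⟫_ℝ : ℝ) : ℂ))
      (Complex.ofRealCLM ∘L innerSL ℝ τ) x :=
    Complex.ofRealCLM.hasFDerivAt.comp x (innerSL ℝ τ).hasFDerivAt
  have h2 : HasFDerivAt (planeWave τ)
      (Complex.exp (Complex.I * (⟪τ, x⟫_ℝ : ℝ)) • (Complex.I • (Complex.ofRealCLM ∘L innerSL ℝ τ)))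
      x := (h1.const_mul Complex.I).cexp
  have h3 := h2.mul (hφ.differentiable_test x).hasFDerivAt
  have h4 : ⟪τ, EuclideanSpace.single j (1 : ℝ)⟫_ℝ = τ j := by
    rw [EuclideanSpace.inner_single_right]
    simp
  unfold partialD
  rw [h3.fderiv]
  change _ = planeWave τ x * _ + ((τ j : ℝ) : ℂ) * (planeWave τ x * φ x)
  simp only [add_apply, smul_apply, ContinuousLinearMap.comp_apply, innerSL_apply_apply, h4,
    Complex.ofRealCLM_apply, smul_eq_mul]
  rw [show Complex.exp (Complex.I * (⟪τ, x⟫_ℝ : ℝ)) = planeWave τ x from rfl]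
  field_simp

theorem foldr_partialD_contDiff (α : Fin d → ℕ) (l : List (Fin d)) {φ : Rd d → ℂ}
    (h : ContDiff ℝ ∞ φ) :
    ContDiff ℝ ∞ (l.foldr (fun j ψ => (partialD j)^[α j] ψ) φ) := by
  induction l with
  | nil => exact h
  | cons j l ih =>
    rw [List.foldr_cons]
    generalize List.foldr (fun j ψ => (partialD j)^[α j] ψ) φ l = ψ at ih
    induction α j with
    | zero => exact ih
    | succ k ihk =>
      rw [Function.iterate_succ_apply']
      exact contDiff_partialD j ihk

theorem contDiff_multiD (α : Fin d → ℕ) {φ : Rd d → ℂ} (h : ContDiff ℝ ∞ φ) :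
    ContDiff ℝ ∞ (multiD α φ) :=
  foldr_partialD_contDiff α _ h

theorem iterate_partialD_comm (j k : Fin d) (n : ℕ) {φ : Rd d → ℂ} (hφ : ContDiff ℝ ∞ φ) :
    (partialD k)^[n] (partialD j φ) = partialD j ((partialD k)^[n] φ) := by
  induction n generalizing φ with
  | zero => rfl
  | succ n ih =>
    rw [Function.iterate_succ_apply, Function.iterate_succ_apply, partialD_comm k j hφ,
      ih (contDiff_partialD k hφ)]

/-- By commutation the extra derivative can be moved to the outside, so inductions on the order may
peel off any coordinate. -/
theorem multiD_add_single (α : Fin d → ℕ) (j : Fin d) {φ : Rd d → ℂ} (hφ : ContDiff ℝ ∞ φ) :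
    multiD (α + Pi.single j 1) φ = partialD j (multiD α φ) := by
  have hnot : ∀ l : List (Fin d), j ∉ l →
      l.foldr (fun k ψ => (partialD k)^[(α + Pi.single j 1 : Fin d → ℕ) k] ψ) φ =
        l.foldr (fun k ψ => (partialD k)^[α k] ψ) φ := by
    intro l hl
    induction l with
    | nil => rfl
    | cons k l ih =>
      rw [List.mem_cons, not_or] at hl
      rw [List.foldr_cons, List.foldr_cons, ih hl.2, Pi.add_apply,
        Pi.single_eq_of_ne (Ne.symm hl.1), add_zero]
  have key : ∀ l : List (Fin d), l.Nodup → j ∈ l →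
      l.foldr (fun k ψ => (partialD k)^[(α + Pi.single j 1 : Fin d → ℕ) k] ψ) φ =
        partialD j (l.foldr (fun k ψ => (partialD k)^[α k] ψ) φ) := by
    intro l hl hj
    induction l with
    | nil => simp at hj
    | cons k l ih =>
      rw [List.nodup_cons] at hl
      rw [List.foldr_cons, List.foldr_cons]
      by_cases hjk : j = k
      · subst hjk
        rw [hnot l hl.1, Pi.add_apply, Pi.single_eq_same, Function.iterate_succ_apply']
      · rw [ih hl.2 ((List.mem_cons.1 hj).resolve_left hjk), Pi.add_apply,
          Pi.single_eq_of_ne (Ne.symm hjk), add_zero,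
          iterate_partialD_comm j k _ (foldr_partialD_contDiff α l hφ)]
  exact key _ (List.nodup_finRange d) (List.mem_finRange j)

theorem multiD_zero (φ : Rd d → ℂ) : multiD (0 : Fin d → ℕ) φ = φ := by
  unfold multiD
  induction List.finRange d with
  | nil => rfl
  | cons j l ih => rw [List.foldr_cons, ih]; rfl

/-- Iteration of `e^{i⟨τ,x⟩} D_j ψ = D_j (e^{i⟨τ,x⟩} ψ) - τ_j e^{i⟨τ,x⟩} ψ`. The wave is moved
inside `D_α` because `e^{i⟨τ,x⟩} φ` is the test function to which the weak derivative of the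
unmodulated `u` applies. Of the coefficients only continuity, vanishing at `0` and independence of
`φ` matter, so they are not computed. -/
theorem exists_leibniz (N : ℕ) : ∀ α : Fin d → ℕ, ∑ i, α i = N →
    ∃ (J : Type) (_ : Fintype J) (β : J → Fin d → ℕ) (c : J → Rd d → ℂ),
      (∀ i, ∑ k, β i k < N) ∧ (∀ i, Continuous (c i)) ∧ (∀ i, c i 0 = 0) ∧
      ∀ (τ : Rd d) (φ : Rd d → ℂ), ContDiff ℝ ∞ φ →
        planeWave τ * multiD α φ = multiD α (planeWave τ * φ) +
          ∑ i, c i τ • multiD (β i) (planeWave τ * φ) := by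
  induction N with
  | zero =>
    intro α hα
    have h0 : α = 0 := by
      funext i
      exact (Finset.sum_eq_zero_iff.1 hα) i (Finset.mem_univ i)
    subst h0
    exact ⟨Empty, inferInstance, Empty.elim, Empty.elim, fun i => i.elim, fun i => i.elim,
      fun i => i.elim, fun τ φ _ => by simp [multiD_zero]⟩
  | succ N ih =>
    intro α' hα'
    obtain ⟨j, hj⟩ : ∃ j, α' j ≠ 0 := by
      by_contra! h
      simp [h] at hα'
    obtain ⟨α, rfl⟩ : ∃ α : Fin d → ℕ, α' = α + Pi.single j 1 := by
      refine ⟨α' - Pi.single j 1, (tsub_add_cancel_of_le fun i => ?_).symm⟩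
      by_cases hij : i = j
      · subst hij
        rw [Pi.single_eq_same]
        exact Nat.one_le_iff_ne_zero.2 hj
      · rw [Pi.single_eq_of_ne hij]
        exact Nat.zero_le _
    have hsum : ∀ β : Fin d → ℕ, ∑ i, (β + Pi.single j 1 : Fin d → ℕ) i = (∑ i, β i) + 1 := fun β => by
      simp [Finset.sum_add_distrib]
    rw [hsum, Nat.add_right_cancel_iff] at hα'
    obtain ⟨J, hJ, β, c, hβ, hc, hc0, hL⟩ := ih α hα'
    have hτ : Continuous fun τ : Rd d => ((τ j : ℝ) : ℂ) :=
      Complex.continuous_ofReal.comp (by fun_prop)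
    -- The left summand holds `D_j` of the old corrections; `none` is `-τ_j` times the main term,
    -- and `some i` is `-τ_j` times an old correction.
    refine ⟨J ⊕ Option J, inferInstance,
      Sum.elim (fun i => β i + Pi.single j 1) (fun o => o.elim α β),
      Sum.elim c (fun o => o.elim (fun τ => -((τ j : ℝ) : ℂ)) fun i τ => -((τ j : ℝ) : ℂ) * c i τ),
      ?_, ?_, ?_, ?_⟩
    · rintro (i | _ | i)
      · simp only [Sum.elim_inl]
        rw [hsum]
        exact Nat.succ_lt_succ (hβ i)
      · simp [hα']
      · exact (hβ i).trans (Nat.lt_succ_self N)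
    · rintro (i | _ | i)
      · exact hc i
      · exact hτ.neg
      · exact hτ.neg.mul (hc i)
    · rintro (i | _ | i)
      · exact hc0 i
      · simp
      · simp
    · intro τ φ hφ
      have hψ : ContDiff ℝ ∞ (planeWave τ * φ) := (contDiff_planeWave τ).mul hφ
      have hs : ∀ i, ContDiff ℝ ∞ (c i τ • multiD (β i) (planeWave τ * φ)) := fun i =>
        contDiff_const.smul (contDiff_multiD (β i) hψ)
      have h1 := partialD_planeWave_mul j τ (contDiff_multiD α hφ)
      rw [multiD_add_single α j hφ, eq_sub_of_add_eq h1.symm, hL τ φ hφ,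
        partialD_add j (contDiff_multiD α hψ), partialD_sum j _ hs]
      · simp only [partialD_smul j _ (contDiff_multiD _ hψ), ← multiD_add_single _ j hψ,
          Fintype.sum_sum_type, Fintype.sum_option, Sum.elim_inl, Sum.elim_inr, Option.elim,
          smul_add, Finset.smul_sum, smul_smul, neg_mul, neg_smul, Finset.sum_neg_distrib]
        abel
      · have := ContDiff.sum (s := Finset.univ) fun i (_ : i ∈ Finset.univ) => hs i
        convert this using 1
        ext x
        simp

/-- The pairing of a function with quasimomentum `t` with a test function, as a linear map. -/
noncomputable def testPairing (b : Module.Basis (Fin d) ℝ (Rd d)) (m : ℕ) (t : Rd d)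
    {φ : Rd d → ℂ} (h : ContDiff ℝ ∞ φ) (h' : HasCompactSupport φ) : L2cell b m →ₗ[ℂ] Cm m where
  toFun u := ∫ x, φ x • quasiExt b t u x
  map_add' u v := integral_smul_quasiExt_add b t u v h h'
  map_smul' c u := integral_smul_quasiExt_smul b t c u φ

variable (b : Module.Basis (Fin d) ℝ (Rd d))

theorem integral_smul_quasiExt_modulation (t τ : Rd d) (u : L2cell b m) (φ : Rd d → ℂ) :
    ∫ x, φ x • quasiExt b (t + τ) (modulation b m τ u) x =
      ∫ x, (planeWave τ * φ) x • quasiExt b t u x := by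
  refine integral_congr_ae ?_
  filter_upwards [quasiExt_modulation b t τ u] with x hx
  rw [hx, smul_smul, Pi.mul_apply, mul_comm]

/-- The weak derivatives of a modulated function. -/
theorem exists_isWeakD_modulation (α : Fin d → ℕ) :
    ∃ (J : Type) (_ : Fintype J) (β : J → Fin d → ℕ) (c : J → Rd d → ℂ),
      (∀ i, ∑ k, β i k < ∑ k, α k) ∧ (∀ i, Continuous (c i)) ∧ (∀ i, c i 0 = 0) ∧
      ∀ (t τ : Rd d) (u g : L2cell b m) (f : J → L2cell b m), IsWeakD b t α u g →
        (∀ i, IsWeakD b t (β i) u (f i)) →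
        IsWeakD b (t + τ) α (modulation b m τ u)
          (modulation b m τ (g + ∑ i, c i τ • f i)) := by
  obtain ⟨J, hJ, β, c, hβ, hc, hc0, hL⟩ := exists_leibniz _ α rfl
  -- The signs arise from integrating by parts `|α|` times for the new derivative and `|β i|` times
  -- for the old ones.
  refine ⟨J, hJ, β, fun i τ => ((-1) ^ (∑ k, α k) * (-1) ^ (∑ k, β i k)) * c i τ, hβ,
    fun i => continuous_const.mul (hc i), fun i => by simp only [hc0, mul_zero], ?_⟩
  intro t τ u g f hg hf φ hφ hφ'
  have hψ : ContDiff ℝ ∞ (planeWave τ * φ) := (contDiff_planeWave τ).mul hφ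
  have hψ' : HasCompactSupport (planeWave τ * φ) := hφ'.mul_left
  have hl := locallyIntegrable_quasiExt b t u
  have hi : ∀ γ : Fin d → ℕ,
      Integrable fun x => multiD γ (planeWave τ * φ) x • quasiExt b t u x := fun γ =>
    integrable_test_smul hl (multiD_test γ hψ hψ').1 (multiD_test γ hψ hψ').2
  rw [integral_smul_quasiExt_modulation, integral_smul_quasiExt_modulation, hL τ φ hφ]
  have h1 : ∫ x, (planeWave τ * φ) x • quasiExt b t (g + ∑ i,
      (((-1) ^ (∑ k, α k) * (-1) ^ (∑ k, β i k)) * c i τ) • f i) x =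
      testPairing b m t hψ hψ' (g + ∑ i,
        (((-1) ^ (∑ k, α k) * (-1) ^ (∑ k, β i k)) * c i τ) • f i) := rfl
  have h2 : testPairing b m t hψ hψ' g =
      (-1 : ℂ) ^ (∑ j, α j) • ∫ x, multiD α (planeWave τ * φ) x • quasiExt b t u x :=
    hg _ hψ hψ'
  have h3 : ∀ i, testPairing b m t hψ hψ' (f i) =
      (-1 : ℂ) ^ (∑ j, β i j) • ∫ x, multiD (β i) (planeWave τ * φ) x • quasiExt b t u x :=
    fun i => hf i _ hψ hψ'
  have h4 : ∫ x, (multiD α (planeWave τ * φ) + ∑ i, c i τ • multiD (β i) (planeWave τ * φ)) x •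
      quasiExt b t u x = (∫ x, multiD α (planeWave τ * φ) x • quasiExt b t u x) +
        ∑ i, c i τ • ∫ x, multiD (β i) (planeWave τ * φ) x • quasiExt b t u x := by
    have e : ∀ x, (multiD α (planeWave τ * φ) + ∑ i, c i τ • multiD (β i) (planeWave τ * φ)) x •
        quasiExt b t u x = multiD α (planeWave τ * φ) x • quasiExt b t u x +
          ∑ i, c i τ • (multiD (β i) (planeWave τ * φ) x • quasiExt b t u x) := fun x => by
      simp only [Pi.add_apply, Finset.sum_apply, Pi.smul_apply, add_smul, Finset.sum_smul,
        smul_assoc]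
    simp_rw [e]
    have hs : ∀ i, Integrable fun x =>
        c i τ • (multiD (β i) (planeWave τ * φ) x • quasiExt b t u x) := fun i =>
      (hi (β i)).smul (c i τ)
    rw [integral_add (hi α) (integrable_finsetSum _ fun i _ => hs i),
      integral_finsetSum _ fun i _ => hs i]
    simp_rw [integral_smul]
  rw [h1, h4, map_add, map_sum, h2, smul_add, Finset.smul_sum]
  congr 1
  refine Finset.sum_congr rfl fun i _ => ?_
  rw [map_smul, h3, smul_smul, smul_smul]
  congr 1
  have h5 : ((-1 : ℂ) ^ (∑ k, β i k)) * (-1) ^ (∑ k, β i k) = 1 := by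
    rw [← mul_pow]
    simp
  linear_combination ((-1 : ℂ) ^ (∑ k, α k) * c i τ) * h5

end Leibniz

/-! ### Continuity of the Bloch family -/

section BlochContinuity

open Filter Topology

variable {d m s : ℕ} {b : Module.Basis (Fin d) ℝ (Rd d)}

/-- The sum of the norms of the weak derivatives of order less than `N`. -/
noncomputable def lowerNorm (b : Module.Basis (Fin d) ℝ (Rd d)) {m : ℕ} (t : Rd d) (N : ℕ)
    (u : L2cell b m) : ℝ :=
  ∑ k ∈ Finset.range N, ∑ α ∈ multiIdx d k, ‖weakD b t α u‖

theorem lowerNorm_nonneg (t : Rd d) (N : ℕ) (u : L2cell b m) : 0 ≤ lowerNorm b t N u :=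
  Finset.sum_nonneg fun _ _ => Finset.sum_nonneg fun _ _ => norm_nonneg _

theorem norm_weakD_le_lowerNorm (t : Rd d) {N : ℕ} (u : L2cell b m) {α : Fin d → ℕ}
    (hα : ∑ k, α k < N) : ‖weakD b t α u‖ ≤ lowerNorm b t N u := by
  have h1 : α ∈ multiIdx d (∑ k, α k) := Finset.mem_piAntidiag.2 ⟨rfl, fun _ _ => Finset.mem_univ _⟩
  refine (Finset.single_le_sum (f := fun α => ‖weakD b t α u‖) (fun _ _ => norm_nonneg _) h1).trans
    (Finset.single_le_sum (f := fun k => ∑ α ∈ multiIdx d k, ‖weakD b t α u‖)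
      (fun _ _ => Finset.sum_nonneg fun _ _ => norm_nonneg _) (Finset.mem_range.2 hα))

theorem isWeakD_weakD {t : Rd d} {N : ℕ} {u : L2cell b m} (hu : u ∈ quasiSobolev b m t N)
    {α : Fin d → ℕ} (hα : ∑ k, α k ≤ N) : IsWeakD b t α u (weakD b t α u) := by
  obtain ⟨g, hg⟩ := hu α hα
  rwa [hg.weakD_eq]

theorem modulation_mem_quasiSobolev {t : Rd d} {N : ℕ} (τ : Rd d) {u : L2cell b m}
    (hu : u ∈ quasiSobolev b m t N) : modulation b m τ u ∈ quasiSobolev b m (t + τ) N := by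
  intro α hα
  obtain ⟨J, _, β, c, hβ, -, -, hL⟩ := exists_isWeakD_modulation (m := m) b α
  exact ⟨_, hL t τ u _ _ (isWeakD_weakD hu hα) fun i =>
    isWeakD_weakD hu ((hβ i).le.trans hα)⟩

theorem modulation_mem_quasiSobolev_iff (t : Rd d) (N : ℕ) (τ : Rd d) (u : L2cell b m) :
    modulation b m τ u ∈ quasiSobolev b m (t + τ) N ↔ u ∈ quasiSobolev b m t N := by
  refine ⟨fun h => ?_, modulation_mem_quasiSobolev τ⟩
  have h1 := modulation_mem_quasiSobolev (-τ) h
  rwa [modulation_neg_apply, add_neg_cancel_right] at h1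

/-- The commutator contains only derivatives of order below `|α|`. So even for `|α| = N` the bound
involves orders less than `N`, which for `N = 2s` are those controlled by (A). -/
theorem exists_norm_weakD_modulation_sub_le (b : Module.Basis (Fin d) ℝ (Rd d)) (m : ℕ)
    (α : Fin d → ℕ) :
    ∃ ρ : Rd d → ℝ, (∀ τ, 0 ≤ ρ τ) ∧ Tendsto ρ (𝓝 0) (𝓝 0) ∧ ∀ (N : ℕ) (t τ : Rd d)
      (u : L2cell b m), ∑ k, α k ≤ N → u ∈ quasiSobolev b m t N →
      ‖weakD b (t + τ) α (modulation b m τ u) - modulation b m τ (weakD b t α u)‖ ≤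
        ρ τ * lowerNorm b t N u := by
  obtain ⟨J, _, β, c, hβ, hc, hc0, hL⟩ := exists_isWeakD_modulation (m := m) b α
  refine ⟨fun τ => ∑ i, ‖c i τ‖, fun τ => Finset.sum_nonneg fun _ _ => norm_nonneg _, ?_, ?_⟩
  · have h1 : Continuous fun τ => ∑ i, ‖c i τ‖ := continuous_finsetSum _ fun i _ => (hc i).norm
    have h2 := h1.tendsto 0
    simpa [hc0] using h2
  · intro N t τ u hα hu
    have h1 := hL t τ u _ _ (isWeakD_weakD hu hα) fun i => isWeakD_weakD hu ((hβ i).le.trans hα)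
    rw [h1.weakD_eq, ← map_sub, LinearIsometryEquiv.norm_map, add_sub_cancel_left, Finset.sum_mul]
    refine (norm_sum_le _ _).trans (Finset.sum_le_sum fun i _ => ?_)
    rw [norm_smul]
    exact mul_le_mul_of_nonneg_left (norm_weakD_le_lowerNorm t u ((hβ i).trans_le hα))
      (norm_nonneg _)

theorem exists_norm_matMul_weakD_modulation_sub_le {M : Rd d → Matrix (Fin m) (Fin m) ℂ}
    (hM : IsBddMatrix M) (α : Fin d → ℕ) :
    ∃ ρ : Rd d → ℝ, (∀ τ, 0 ≤ ρ τ) ∧ Tendsto ρ (𝓝 0) (𝓝 0) ∧ ∀ (N : ℕ) (t τ : Rd d)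
      (u : L2cell b m), ∑ k, α k ≤ N → u ∈ quasiSobolev b m t N →
      ‖matMul b M hM (weakD b (t + τ) α (modulation b m τ u)) -
        modulation b m τ (matMul b M hM (weakD b t α u))‖ ≤ ρ τ * lowerNorm b t N u := by
  obtain ⟨C, hC0, hC⟩ := exists_norm_matMul_le b hM
  obtain ⟨ρ, hρ0, hρ, h⟩ := exists_norm_weakD_modulation_sub_le b m α
  refine ⟨fun τ => C * ρ τ, fun τ => mul_nonneg hC0 (hρ0 τ), by simpa using hρ.const_mul C, ?_⟩
  intro N t τ u hα hu
  rw [← matMul_modulation, ← map_sub, mul_assoc]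
  exact (hC _).trans (mul_le_mul_of_nonneg_left (h N t τ u hα hu) hC0)

theorem PeriodicExpr.bloch_apply (T : PeriodicExpr b m s) (t : Rd d) (u : L2cell b m)
    (hu : u ∈ (T.bloch t).domain) : T.bloch t ⟨u, hu⟩ =
      (∑ α ∈ multiIdx d (2 * s),
        matMul b (fun _ => (T.lead α).map (fun r : ℝ => (r : ℂ))) (isBddMatrix_const _)
          (weakD b t α u)) +
      (∑ k ∈ Finset.range (2 * s), ∑ α ∈ multiIdx d k,
        matMul b (T.low α) (T.low_bdd α) (weakD b t α u)) + T.B t u := rfl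

/-- `B_t` need not commute with modulations. The difference splits into the variation of `B` in `t`
and two terms in which a modulation is compared with the identity. -/
theorem norm_B_modulation_sub_le (T : PeriodicExpr b m s) (t τ : Rd d) (u : L2cell b m) :
    ‖T.B (t + τ) (modulation b m τ u) - modulation b m τ (T.B t u)‖ ≤
      (‖T.B (t + τ) - T.B t‖ + 2 * ‖T.B t‖ * (‖τ‖ * ∑ i, ‖b i‖)) * ‖u‖ := by
  have h1 : T.B (t + τ) (modulation b m τ u) - modulation b m τ (T.B t u) =
      (T.B (t + τ) - T.B t) (modulation b m τ u) + T.B t (modulation b m τ u - u) -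
        (modulation b m τ (T.B t u) - T.B t u) := by
    rw [sub_apply, map_sub]
    abel
  have hR : 0 ≤ ‖τ‖ * ∑ i, ‖b i‖ :=
    mul_nonneg (norm_nonneg _) (Finset.sum_nonneg fun _ _ => norm_nonneg _)
  have h2 := (T.B (t + τ) - T.B t).le_opNorm (modulation b m τ u)
  have h3 := ((T.B t).le_opNorm (modulation b m τ u - u)).trans
    (mul_le_mul_of_nonneg_left (norm_modulation_sub_le b τ u) (norm_nonneg _))
  have h4 := (norm_modulation_sub_le b τ (T.B t u)).trans
    (mul_le_mul_of_nonneg_left ((T.B t).le_opNorm u) hR)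
  rw [LinearIsometryEquiv.norm_map] at h2
  rw [h1]
  refine (norm_sub_le _ _).trans ((add_le_add ((norm_add_le _ _).trans (add_le_add h2 h3)) h4).trans
    (le_of_eq (by ring)))

theorem exists_norm_bloch_modulation_sub_le (T : PeriodicExpr b m s) (t : Rd d) :
    ∃ ρ : Rd d → ℝ, Tendsto ρ (𝓝 0) (𝓝 0) ∧ ∀ (τ : Rd d) (u : L2cell b m)
      (hu : u ∈ (T.bloch t).domain) (hu' : modulation b m τ u ∈ (T.bloch (t + τ)).domain),
      ‖T.bloch (t + τ) ⟨modulation b m τ u, hu'⟩ - modulation b m τ (T.bloch t ⟨u, hu⟩)‖ ≤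
        ρ τ * (lowerNorm b t (2 * s) u + ‖u‖) := by
  choose ρ₁ hρ₁0 hρ₁ h₁ using fun α : Fin d → ℕ => exists_norm_matMul_weakD_modulation_sub_le (b := b)
    (isBddMatrix_const (d := d) ((T.lead α).map (fun r : ℝ => (r : ℂ)))) α
  choose ρ₂ hρ₂0 hρ₂ h₂ using fun α : Fin d → ℕ => exists_norm_matMul_weakD_modulation_sub_le (b := b)
    (T.low_bdd α) α
  have hB : Tendsto (fun τ => ‖T.B (t + τ) - T.B t‖ + 2 * ‖T.B t‖ * (‖τ‖ * ∑ i, ‖b i‖))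
      (𝓝 0) (𝓝 0) := by
    have hc : Continuous fun τ =>
        ‖T.B (t + τ) - T.B t‖ + 2 * ‖T.B t‖ * (‖τ‖ * ∑ i, ‖b i‖) := by
      have := T.B_continuous
      fun_prop
    simpa using hc.tendsto 0
  refine ⟨fun τ => (∑ α ∈ multiIdx d (2 * s), ρ₁ α τ +
    ∑ k ∈ Finset.range (2 * s), ∑ α ∈ multiIdx d k, ρ₂ α τ) +
    (‖T.B (t + τ) - T.B t‖ + 2 * ‖T.B t‖ * (‖τ‖ * ∑ i, ‖b i‖)), ?_, ?_⟩
  · have e1 := tendsto_finsetSum (multiIdx d (2 * s)) fun α _ => hρ₁ α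
    have e2 := tendsto_finsetSum (Finset.range (2 * s)) fun k _ =>
      tendsto_finsetSum (multiIdx d k) fun α _ => hρ₂ α
    simpa using (e1.add e2).add hB
  · intro τ u hu hu'
    have hsum : ∀ {k : ℕ} {α : Fin d → ℕ}, α ∈ multiIdx d k → ∑ j, α j = k := fun hα =>
      (Finset.mem_piAntidiag.1 hα).1
    have a1 : ‖∑ α ∈ multiIdx d (2 * s),
        (matMul b (fun _ => (T.lead α).map (fun r : ℝ => (r : ℂ))) (isBddMatrix_const _)
          (weakD b (t + τ) α (modulation b m τ u)) - modulation b m τ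
        (matMul b (fun _ => (T.lead α).map (fun r : ℝ => (r : ℂ))) (isBddMatrix_const _)
          (weakD b t α u)))‖ ≤ (∑ α ∈ multiIdx d (2 * s), ρ₁ α τ) * lowerNorm b t (2 * s) u := by
      rw [Finset.sum_mul]
      exact (norm_sum_le _ _).trans (Finset.sum_le_sum fun α hα =>
        h₁ α (2 * s) t τ u (hsum hα).le hu)
    have a2 : ‖∑ k ∈ Finset.range (2 * s), ∑ α ∈ multiIdx d k,
        (matMul b (T.low α) (T.low_bdd α) (weakD b (t + τ) α (modulation b m τ u)) -
          modulation b m τ (matMul b (T.low α) (T.low_bdd α) (weakD b t α u)))‖ ≤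
        (∑ k ∈ Finset.range (2 * s), ∑ α ∈ multiIdx d k, ρ₂ α τ) * lowerNorm b t (2 * s) u := by
      rw [Finset.sum_mul]
      refine (norm_sum_le _ _).trans (Finset.sum_le_sum fun k hk => ?_)
      rw [Finset.sum_mul]
      exact (norm_sum_le _ _).trans (Finset.sum_le_sum fun α hα =>
        h₂ α (2 * s) t τ u ((hsum hα).le.trans (Finset.mem_range.1 hk).le) hu)
    have a3 := norm_B_modulation_sub_le T t τ u
    have n1 : 0 ≤ ∑ α ∈ multiIdx d (2 * s), ρ₁ α τ +
        ∑ k ∈ Finset.range (2 * s), ∑ α ∈ multiIdx d k, ρ₂ α τ :=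
      add_nonneg (Finset.sum_nonneg fun α _ => hρ₁0 α τ)
        (Finset.sum_nonneg fun k _ => Finset.sum_nonneg fun α _ => hρ₂0 α τ)
    have n2 : 0 ≤ ‖T.B (t + τ) - T.B t‖ + 2 * ‖T.B t‖ * (‖τ‖ * ∑ i, ‖b i‖) :=
      add_nonneg (norm_nonneg _) (mul_nonneg (by positivity) (mul_nonneg (norm_nonneg _)
        (Finset.sum_nonneg fun _ _ => norm_nonneg _)))
    have e : T.bloch (t + τ) ⟨modulation b m τ u, hu'⟩ - modulation b m τ (T.bloch t ⟨u, hu⟩) =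
        (∑ α ∈ multiIdx d (2 * s),
          (matMul b (fun _ => (T.lead α).map (fun r : ℝ => (r : ℂ))) (isBddMatrix_const _)
            (weakD b (t + τ) α (modulation b m τ u)) - modulation b m τ
          (matMul b (fun _ => (T.lead α).map (fun r : ℝ => (r : ℂ))) (isBddMatrix_const _)
            (weakD b t α u)))) +
        (∑ k ∈ Finset.range (2 * s), ∑ α ∈ multiIdx d k,
          (matMul b (T.low α) (T.low_bdd α) (weakD b (t + τ) α (modulation b m τ u)) -
            modulation b m τ (matMul b (T.low α) (T.low_bdd α) (weakD b t α u)))) +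
        (T.B (t + τ) (modulation b m τ u) - modulation b m τ (T.B t u)) := by
      rw [T.bloch_apply, T.bloch_apply, map_add, map_add, map_sum, map_sum]
      simp only [map_sum, Finset.sum_sub_distrib]
      abel
    rw [e]
    refine (norm_add_le _ _).trans ((add_le_add ((norm_add_le _ _).trans (add_le_add a1 a2))
      a3).trans ?_)
    have p1 := mul_nonneg n1 (norm_nonneg u)
    have p2 := mul_nonneg n2 (lowerNorm_nonneg t (2 * s) u)
    linarith

/-- The hypothesis `hK`, which (A) provides, converts the lower-order error into a relative bound
with respect to `T_t`. -/
theorem eventually_isGraphClose (T : PeriodicExpr b m s) {t : Rd d} {K : ℝ}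
    (hK : ∀ (u : L2cell b m) (hu : u ∈ (T.bloch t).domain),
      lowerNorm b t (2 * s) u ≤ K * (‖T.bloch t ⟨u, hu⟩‖ + ‖u‖)) {δ : ℝ} (hδ : 0 < δ) :
    ∀ᶠ τ in 𝓝 (0 : Rd d),
      IsGraphClose (modulation b m τ) (T.bloch t) (T.bloch (t + τ)) δ := by
  obtain ⟨ρ, hρ, h⟩ := exists_norm_bloch_modulation_sub_le T t
  have h1 : Tendsto (fun τ => |ρ τ| * (|K| + 1)) (𝓝 0) (𝓝 0) := by
    simpa using hρ.abs.mul_const (|K| + 1)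
  filter_upwards [h1.eventually (gt_mem_nhds hδ)] with τ hτ
  refine ⟨fun u => modulation_mem_quasiSobolev_iff t (2 * s) τ u, fun u hu hu' => ?_⟩
  have hn : 0 ≤ ‖T.bloch t ⟨u, hu⟩‖ + ‖u‖ := by positivity
  have h2 : lowerNorm b t (2 * s) u + ‖u‖ ≤ (|K| + 1) * (‖T.bloch t ⟨u, hu⟩‖ + ‖u‖) := by
    have h3 := (hK u hu).trans (mul_le_mul_of_nonneg_right (le_abs_self K) hn)
    linarith [norm_nonneg (T.bloch t ⟨u, hu⟩)]
  calc _ ≤ ρ τ * (lowerNorm b t (2 * s) u + ‖u‖) := h τ u hu hu'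
    _ ≤ |ρ τ| * ((|K| + 1) * (‖T.bloch t ⟨u, hu⟩‖ + ‖u‖)) :=
      mul_le_mul (le_abs_self _) h2 (add_nonneg (lowerNorm_nonneg _ _ _) (norm_nonneg _))
        (abs_nonneg _)
    _ ≤ _ := by
      rw [← mul_assoc]
      exact mul_le_mul_of_nonneg_right hτ.le hn

/-- The terms `c u` and `B_t u` in (A) are bounded and go into `K`. It may depend on `t`, since the
perturbation argument compares with one fixed `T_t`. -/
theorem PeriodicExpr.Admissible.exists_lowerNorm_le {T : PeriodicExpr b m s} {E : Set (Rd d)}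
    (hT : T.Admissible E) {t : Rd d} (ht : t ∈ E) :
    ∃ K : ℝ, ∀ (u : L2cell b m) (hu : u ∈ (T.bloch t).domain),
      lowerNorm b t (2 * s) u ≤ K * (‖T.bloch t ⟨u, hu⟩‖ + ‖u‖) := by
  obtain ⟨-, ε, hε, c, hc, h⟩ := hT
  refine ⟨ε⁻¹ * (1 + c + ‖T.B t‖), fun u hu => ?_⟩
  have h1 := h t ht ⟨u, hu⟩
  have h2 : ‖T.bloch t ⟨u, hu⟩ + (c : ℂ) • u - T.B t u‖ ≤
      ‖T.bloch t ⟨u, hu⟩‖ + c * ‖u‖ + ‖T.B t‖ * ‖u‖ := by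
    refine (norm_sub_le _ _).trans (add_le_add ((norm_add_le _ _).trans (add_le_add le_rfl ?_))
      ((T.B t).le_opNorm u))
    rw [norm_smul, Complex.norm_real, Real.norm_of_nonneg hc.le]
  rw [mul_assoc, le_inv_mul_iff₀ hε]
  refine h1.trans ((add_le_add h2 le_rfl).trans ?_)
  have h3 : 0 ≤ (c + ‖T.B t‖) * ‖T.bloch t ⟨u, hu⟩‖ := by positivity
  simp only
  linarith

theorem PeriodicExpr.Admissible.eventually_isSimpleEig {T : PeriodicExpr b m s} (hd : 1 ≤ d)
    (hm : 1 ≤ m) (hT : T.Admissible Set.univ) {n : ℕ} (hn : 1 ≤ n) {t : Rd d}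
    (hs : IsSimpleEig (T.bloch t) (T.band n t)) {η : ℝ} (hη : 0 < η) :
    ∀ᶠ t' in 𝓝 t, IsSimpleEig (T.bloch t') (T.band n t') ∧ ∀ ψ φ : L2cell b m,
      IsNormalizedEig (T.bloch t) (T.band n t) ψ →
      IsNormalizedEig (T.bloch t') (T.band n t') φ →
      ∃ κ : ℂ, ‖(modulation b m (t' - t)).symm φ - κ • ψ‖ ≤ η := by
  obtain ⟨δ, hδ, h⟩ := (hT.1 t (Set.mem_univ t)).simple_stable
    (not_finiteDimensional_L2cell b hd hm) hn hs hη
  obtain ⟨K, hK⟩ := hT.exists_lowerNorm_le (Set.mem_univ t)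
  have h1 : Tendsto (fun t' => t' - t) (𝓝 t) (𝓝 0) := by
    have h2 : Continuous fun t' => t' - t := by fun_prop
    simpa using h2.tendsto t
  filter_upwards [h1.eventually (eventually_isGraphClose T hK hδ)] with t' ht'
  rw [add_sub_cancel] at ht'
  exact h _ _ (hT.1 t' (Set.mem_univ t')) ht'

/-- The scalar `κ` need not be unimodular, but since both eigenvectors have norm one, `|κ|` is
within `η` of `1`. One `‖K‖ η` comes from the vector error, the other from `|κ|`; the phase of `κ`
disappears in the modulus. -/
theorem norm_planeCoeff_sub_le {t t' : Rd d} {v : Cm m} {K ψ φ : L2cell b m} {η : ℝ}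
    (hK : ∀ Ψ, planeCoeff b t v Ψ = ⟪K, Ψ⟫_ℂ) (hψ : ‖ψ‖ = 1) (hφ : ‖φ‖ = 1) {κ : ℂ}
    (h : ‖(modulation b m (t' - t)).symm φ - κ • ψ‖ ≤ η) :
    |‖planeCoeff b t' v φ‖ - ‖planeCoeff b t v ψ‖| ≤ 2 * ‖K‖ * η := by
  set x := (modulation b m (t' - t)).symm φ with hx
  have h1 : planeCoeff b t' v φ = ⟪K, x⟫_ℂ := by
    have := planeCoeff_modulation b t (t' - t) v x
    rwa [add_sub_cancel, hx, LinearIsometryEquiv.apply_symm_apply, hK] at this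
  have hx1 : ‖x‖ = 1 := by rw [hx, LinearIsometryEquiv.norm_map, hφ]
  have h2 : |‖⟪K, x⟫_ℂ‖ - ‖κ‖ * ‖⟪K, ψ⟫_ℂ‖| ≤ ‖K‖ * η := by
    rw [← norm_mul, ← inner_smul_right]
    refine (abs_norm_sub_norm_le _ _).trans ?_
    rw [← inner_sub_right]
    exact (norm_inner_le_norm _ _).trans (mul_le_mul_of_nonneg_left h (norm_nonneg _))
  have h3 : |‖κ‖ - 1| ≤ η := by
    have := (abs_norm_sub_norm_le x (κ • ψ)).trans h
    rwa [hx1, norm_smul, hψ, mul_one, abs_sub_comm] at this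
  have h4 : ‖⟪K, ψ⟫_ℂ‖ ≤ ‖K‖ := by
    have := norm_inner_le_norm (𝕜 := ℂ) K ψ
    rwa [hψ, mul_one] at this
  have h5 : |‖κ‖ * ‖⟪K, ψ⟫_ℂ‖ - ‖⟪K, ψ⟫_ℂ‖| ≤ η * ‖K‖ := by
    rw [← sub_one_mul, abs_mul, abs_of_nonneg (norm_nonneg ⟪K, ψ⟫_ℂ)]
    exact mul_le_mul h3 h4 (norm_nonneg _) ((abs_nonneg _).trans h3)
  rw [h1, hK]
  have := abs_sub_le ‖⟪K, x⟫_ℂ‖ (‖κ‖ * ‖⟪K, ψ⟫_ℂ‖) ‖⟪K, ψ⟫_ℂ‖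
  linarith

theorem PeriodicExpr.Admissible.continuousModulusOn {T : PeriodicExpr b m s} (hd : 1 ≤ d)
    (hm : 1 ≤ m) (hT : T.Admissible Set.univ) {n : ℕ} (hn : 1 ≤ n) {U : Set (Rd d)}
    (hU : ∀ t ∈ U, IsSimpleEig (T.bloch t) (T.band n t)) : T.ContinuousModulusOn n U := by
  refine ⟨hU, fun v => ⟨fun t ht Ψ Ψ' hΨ hΨ' => ?_, fun Ψ hΨ t ht => ?_⟩⟩
  · have h1 := hU t ht
    have h0 : (⟨Ψ, hΨ.1⟩ : eigSpace (T.bloch t) (T.band n t)) ≠ 0 := fun h => by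
      have := congrArg (fun w : eigSpace (T.bloch t) (T.band n t) => ‖(w : L2cell b m)‖) h
      simp [hΨ.2] at this
    -- Two normalized eigenfunctions of a simple eigenvalue differ by a unimodular factor.
    obtain ⟨c, hc⟩ := (finrank_eq_one_iff_of_nonzero' _ h0).1 h1 ⟨Ψ', hΨ'.1⟩
    have hc' : c • Ψ = Ψ' := congrArg Subtype.val hc
    have hc1 : ‖c‖ = 1 := by
      have := congrArg norm hc'
      rwa [norm_smul, hΨ.2, hΨ'.2, mul_one] at this
    obtain ⟨K, hK⟩ := exists_planeCoeff_eq_inner b t v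
    rw [hK, hK, ← hc', inner_smul_right, norm_mul, hc1, one_mul]
  · obtain ⟨K, hK⟩ := exists_planeCoeff_eq_inner b t v
    rw [ContinuousWithinAt, Metric.tendsto_nhds]
    intro ε hε
    have hη : 0 < ε / (2 * ‖K‖ + 1) := by positivity
    filter_upwards [nhdsWithin_le_nhds (hT.eventually_isSimpleEig hd hm hn (hU t ht) hη),
      self_mem_nhdsWithin] with t' ht' htU
    obtain ⟨κ, hκ⟩ := ht'.2 _ _ (hΨ t ht) (hΨ t' htU)
    refine lt_of_le_of_lt (norm_planeCoeff_sub_le hK (hΨ t ht).2 (hΨ t' htU).2 hκ) ?_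
    rw [← mul_div_assoc, div_lt_iff₀ (by positivity)]
    nlinarith [norm_nonneg K]

theorem PeriodicExpr.Admissible.isOpen_simple {T : PeriodicExpr b m s} (hd : 1 ≤ d)
    (hm : 1 ≤ m) (hT : T.Admissible Set.univ) {n : ℕ} (hn : 1 ≤ n) :
    IsOpen {t | IsSimpleEig (T.bloch t) (T.band n t)} :=
  isOpen_iff_mem_nhds.2 fun _ ht =>
    (hT.eventually_isSimpleEig hd hm hn ht one_pos).mono fun _ h => h.1

end BlochContinuity

/-! ### Periodicity in the quasimomentum and fundamental sets -/

section Periodicity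

variable {d m s : ℕ} {b : Module.Basis (Fin d) ℝ (Rd d)}

theorem quasiExt_congr {t t' : Rd d} (h : t - t' ∈ dualLattice b) :
    (quasiExt b t : L2cell b m → Rd d → Cm m) = quasiExt b t' := by
  funext u x
  unfold quasiExt
  congr 1
  obtain ⟨k, hk⟩ := h (ZSpan.floor b x) (ZSpan.floor b x).2
  rw [inner_sub_left, sub_eq_iff_eq_add] at hk
  rw [hk, Complex.exp_eq_exp_iff_exists_int]
  refine ⟨k, ?_⟩
  push_cast
  ring

theorem isWeakD_congr {t t' : Rd d} (h : t - t' ∈ dualLattice b) :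
    (IsWeakD b t : (Fin d → ℕ) → L2cell b m → L2cell b m → Prop) = IsWeakD b t' := by
  unfold IsWeakD
  rw [quasiExt_congr h]

theorem weakD_congr {t t' : Rd d} (h : t - t' ∈ dualLattice b) :
    (weakD b t : (Fin d → ℕ) → L2cell b m → L2cell b m) = weakD b t' := by
  unfold weakD
  rw [isWeakD_congr h]

theorem PeriodicExpr.B_congr (T : PeriodicExpr b m s) {t t' : Rd d}
    (h : t - t' ∈ dualLattice b) : T.B t = T.B t' := by
  rw [← T.B_periodic _ h t', sub_add_cancel]

/-- Apart from `B_t`, the quasimomentum enters only through the factors `e^{i⟨t,ω⟩}` in `quasiExt`,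
which do not see `Γ`. -/
theorem PeriodicExpr.bloch_congr (T : PeriodicExpr b m s) {t t' : Rd d}
    (h : t - t' ∈ dualLattice b) : T.bloch t = T.bloch t' := by
  have hdom : (T.bloch t).domain = (T.bloch t').domain := by
    refine Submodule.ext fun u => ?_
    change (∀ α : Fin d → ℕ, ∑ j, α j ≤ 2 * s → ∃ g, IsWeakD b t α u g) ↔
      (∀ α : Fin d → ℕ, ∑ j, α j ≤ 2 * s → ∃ g, IsWeakD b t' α u g)
    rw [isWeakD_congr h]
  refine LinearPMap.ext hdom fun u hu hu' => ?_
  rw [T.bloch_apply, T.bloch_apply, weakD_congr h, T.B_congr h]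

/-- Congruent quasimomenta give the same operator, so the constants persist. Working on all of `ℝ^d`
lets neighbourhoods of a point leave `F^⋆`. -/
theorem PeriodicExpr.Admissible.univ {T : PeriodicExpr b m s} {E : Set (Rd d)}
    (hE : CoversMod (dualLattice b) E) (hT : T.Admissible E) : T.Admissible Set.univ := by
  have hrep : ∀ t : Rd d, ∃ t' ∈ E, t - t' ∈ dualLattice b := fun t => by
    obtain ⟨t', ht', γ, hγ, rfl⟩ := (hE.symm ▸ Set.mem_univ t :
      t ∈ {x : Rd d | ∃ t ∈ E, ∃ γ ∈ dualLattice b, x = γ + t})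
    exact ⟨t', ht', by rwa [add_sub_cancel_right]⟩
  obtain ⟨hsbc, ε, hε, c, hc, h⟩ := hT
  refine ⟨fun t _ => ?_, ε, hε, c, hc, fun t _ => ?_⟩
  · obtain ⟨t', ht', hγ⟩ := hrep t
    rw [T.bloch_congr hγ]
    exact hsbc t' ht'
  · obtain ⟨t', ht', hγ⟩ := hrep t
    rw [T.bloch_congr hγ, weakD_congr hγ, T.B_congr hγ]
    exact h t' ht'

theorem PeriodicExpr.Admissible.mono {T : PeriodicExpr b m s} {E E' : Set (Rd d)}
    (hT : T.Admissible E) (h : E' ⊆ E) : T.Admissible E' := by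
  obtain ⟨hsbc, ε, hε, c, hc, hb⟩ := hT
  exact ⟨fun t ht => hsbc t (h ht), ε, hε, c, hc, fun t ht => hb t (h ht)⟩

/-- A short `γ` pairs with each basis vector to a multiple of `2π` smaller than `2π` in modulus,
hence to zero. -/
theorem exists_pos_forall_mem_dualLattice (b : Module.Basis (Fin d) ℝ (Rd d)) :
    ∃ r : ℝ, 0 < r ∧ ∀ γ ∈ dualLattice b, ‖γ‖ < r → γ = 0 := by
  have hS : 0 ≤ ∑ i, ‖b i‖ := Finset.sum_nonneg fun _ _ => norm_nonneg _
  refine ⟨2 * Real.pi / (1 + ∑ i, ‖b i‖), by positivity, fun γ hγ hr => ?_⟩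
  rw [lt_div_iff₀ (by positivity)] at hr
  have h0 : ∀ i, ⟪b i, γ⟫_ℝ = 0 := by
    intro i
    obtain ⟨k, hk⟩ := hγ (b i) (Submodule.subset_span ⟨i, rfl⟩)
    have h1 : |⟪γ, b i⟫_ℝ| < 2 * Real.pi := by
      refine lt_of_le_of_lt (abs_real_inner_le_norm _ _) (lt_of_le_of_lt
        (mul_le_mul_of_nonneg_left ?_ (norm_nonneg _)) hr)
      have := Finset.single_le_sum (f := fun i => ‖b i‖) (fun _ _ => norm_nonneg _)
        (Finset.mem_univ i)
      linarith
    rw [hk, abs_mul, abs_of_pos Real.two_pi_pos] at h1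
    have h2 : |(k : ℝ)| < 1 := by
      by_contra! h3
      nlinarith [Real.two_pi_pos]
    have h3 : k = 0 := Int.abs_lt_one_iff.1 (by exact_mod_cast h2)
    rw [real_inner_comm, hk, h3]
    simp
  exact InnerProductSpace.ext_inner_left_basis b (by simpa using h0)

/-- Choose a representative in each class modulo `Γ`, from `U` whenever the class meets `U`; as `U`
meets each class at most once, all of `U` is chosen. -/
theorem exists_isFundamentalSet_superset (Γ : AddSubgroup (Rd d)) {U : Set (Rd d)}
    (hU : ∀ x ∈ U, ∀ y ∈ U, x - y ∈ Γ → x = y) : ∃ E, IsFundamentalSet Γ E ∧ U ⊆ E := by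
  classical
  have hex : ∀ q : Rd d ⧸ Γ, ∃ x : Rd d, (x : Rd d ⧸ Γ) = q ∧
      ((∃ y ∈ U, (y : Rd d ⧸ Γ) = q) → x ∈ U) := fun q => by
    by_cases h : ∃ y ∈ U, (y : Rd d ⧸ Γ) = q
    · obtain ⟨y, hy, hyq⟩ := h
      exact ⟨y, hyq, fun _ => hy⟩
    · obtain ⟨x, hx⟩ := QuotientAddGroup.mk_surjective q
      exact ⟨x, hx, fun h' => absurd h' h⟩
  choose rep hrep hrepU using hex
  refine ⟨Set.range rep, ⟨Set.eq_univ_of_forall fun x => ?_, ?_⟩, fun x hx => ?_⟩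
  · refine ⟨rep x, ⟨_, rfl⟩, x - rep x, ?_, by abel⟩
    have := QuotientAddGroup.eq.1 (hrep (x : Rd d ⧸ Γ))
    rwa [neg_add_eq_sub] at this
  · rintro _ ⟨q, rfl⟩ γ hγ hγ0 ⟨q', hq'⟩
    have h1 : q' = q := by
      rw [← hrep q', ← hrep q, hq', eq_comm, QuotientAddGroup.eq]
      simpa using hγ
    rw [h1] at hq'
    exact hγ0 (by simpa using hq'.symm)
  · refine ⟨(x : Rd d ⧸ Γ), hU _ (hrepU _ ⟨x, hx, rfl⟩) _ hx ?_⟩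
    have := QuotientAddGroup.eq.1 (hrep (x : Rd d ⧸ Γ))
    rw [neg_add_eq_sub] at this
    rw [← neg_sub]
    exact neg_mem this

theorem IsFundamentalSet.existsUnique {Γ : AddSubgroup (Rd d)} {E : Set (Rd d)}
    (hE : IsFundamentalSet Γ E) (t : Rd d) : ∃! t' : Rd d, t' ∈ E ∧ t - t' ∈ Γ := by
  obtain ⟨t', ht', γ, hγ, rfl⟩ := (hE.1.symm ▸ Set.mem_univ t :
    t ∈ {x : Rd d | ∃ t ∈ E, ∃ γ ∈ Γ, x = γ + t})
  refine ⟨t', ⟨ht', by rwa [add_sub_cancel_right]⟩, fun y hy => ?_⟩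
  by_contra hne
  have h1 : y - t' ∈ Γ := by
    have := sub_mem hγ hy.2
    rwa [show γ - (γ + t' - y) = y - t' by abel] at this
  refine hE.2 t' ht' (y - t') h1 (sub_ne_zero.2 hne) ?_
  rw [sub_add_cancel]
  exact hy.1

end Periodicity

/-! ### Neighbourhoods of simple eigenvalues and the choice of fundamental set -/

theorem proposition1 {d m s : ℕ} (hd : 1 ≤ d) (hm : 1 ≤ m) (hs : 1 ≤ s)
    (b : Module.Basis (Fin d) ℝ (Rd d)) (T : PeriodicExpr b m s)
    (Fstar : Set (Rd d)) (hF : CoversMod (dualLattice b) Fstar) (hT : T.Admissible Fstar) :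
    (∀ (n : ℕ) (a : Rd d), 1 ≤ n → IsSimpleEig (T.bloch a) (T.band n a) →
      ∃ U : Set (Rd d), IsOpen U ∧ a ∈ U ∧
        (∃ E : Set (Rd d), IsFundamentalSet (dualLattice b) E ∧ U ⊆ E) ∧
        T.ContinuousModulusOn n U) ∧
    (∀ E : Set (Rd d), IsFundamentalSet (dualLattice b) E →
      (∀ t : Rd d, ∃! t' : Rd d, t' ∈ E ∧ t - t' ∈ dualLattice b) ∧
      (∀ t t' : Rd d, t - t' ∈ dualLattice b → T.bloch t = T.bloch t') ∧
      T.Admissible E ∧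
      ∀ (n : ℕ) (a : Rd d), 1 ≤ n → a ∈ E → IsSimpleEig (T.bloch a) (T.band n a) →
        ∃ U : Set (Rd d), U ∈ nhdsWithin a E ∧ U ⊆ E ∧ T.ContinuousModulusOn n U) := by
  have hT' := hT.univ hF
  refine ⟨fun n a hn ha => ?_, fun E hE => ⟨hE.existsUnique, fun t t' h => T.bloch_congr h,
    hT'.mono (Set.subset_univ E), fun n a hn haE ha => ?_⟩⟩
  · obtain ⟨r, hr, hΓ⟩ := exists_pos_forall_mem_dualLattice b
    -- Two points of the ball are less than `r` apart, so they are congruent modulo `Γ` only if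
    -- equal.
    refine ⟨{t | IsSimpleEig (T.bloch t) (T.band n t)} ∩ Metric.ball a (r / 2),
      (hT'.isOpen_simple hd hm hn).inter Metric.isOpen_ball,
      ⟨ha, Metric.mem_ball_self (by positivity)⟩, ?_,
      hT'.continuousModulusOn hd hm hn fun t ht => ht.1⟩
    refine exists_isFundamentalSet_superset _ fun x hx y hy hxy => ?_
    refine sub_eq_zero.1 (hΓ _ hxy ?_)
    rw [← dist_eq_norm]
    have h1 := Metric.mem_ball.1 hx.2
    have h2 := Metric.mem_ball.1 hy.2
    have h3 := dist_triangle_right x y a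
    linarith
  · refine ⟨{t | IsSimpleEig (T.bloch t) (T.band n t)} ∩ E, Filter.inter_mem
      (nhdsWithin_le_nhds ((hT'.isOpen_simple hd hm hn).mem_nhds ha)) self_mem_nhdsWithin,
      Set.inter_subset_right, hT'.continuousModulusOn hd hm hn fun t ht => ht.1⟩
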